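/- **Definitions.** All systems have time set $\mathbb R_0^+$. An input space $\mathcal U$ over a vector space $U$ is a normed linear space of functions $u:\mathbb R_0^+\to U$ (functions at distance zero being identified) such that, for all $\tau\ge 0$ and $t_2\ge t_1\ge0$, the shift $u(\cdot+\tau)$ and the restriction of $u$ to $[t_1,t_2]$ (extended by $0$) belong to $\mathcal U$ and have norm at most $\|u\|_{\mathcal U}$. A control system with outputs consists of normed spaces $X$ (states) and $Y$ (outputs), an input space $\mathcal U$, a transition map $t\mapsto\phi(t,x,u)\in X$ defined on a maximal interval $[0,t_m(x,u))$, $t_m\in(0,\infty]$, satisfying the identity, causality and cocycle axioms, and an output map $h:X\times U\to Y$; put $y(t,x,u)=h(\phi(t,x,u),u(t))$. It is forward complete (FC) if $t_m(x,u)=\infty$ for all $x,u$, and has full-state output if $Y=X$ and $h(x,u)=x$. Let $\mathcal K_\infty$ be the set of continuous, strictly increasing, unbounded $\gamma:\mathbb R_0^+\to\mathbb R_0^+$ with $\gamma(0)=0$. A forward complete system is * BORS if $\sup\{\|y(t,x,u)\|_Y:\|x\|_X<C,\ \|u\|_{\mathcal U}<C,\ t<\tau\}<\infty$ for all $C>0$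 and $\tau\ge 0$; * OULS if there are $r>0$ and $\sigma,\gamma\in\mathcal K_\infty$ with $\|y(t,x,u)\|_Y\le\sigma(\|x\|_X)+\gamma(\|u\|_{\mathcal U})$ for all $t\ge0$, $\|x\|_X<r$, $\|u\|_{\mathcal U}<r$; for full-state output this is called ULS; * OUAG with gain $\gamma$ if for all $\varepsilon,r,s>0$ there is $\tau\ge 0$ such that $\|y(t,x,u)\|_Y\le\varepsilon+\gamma(\|u\|_{\mathcal U})$ for all $\|x\|_X<r$, $\|u\|_{\mathcal U}<s$, $t\ge\tau$; it is OUAG if this holds for some $\gamma\in\mathcal K_\infty$; * OGUAG if there is $\gamma\in\mathcal K_\infty$ such that for all $\varepsilon,r>0$ there is $\tau\ge 0$ such that $\|y(t,x,u)\|_Y\le\varepsilon+\gamma(\|u\|_{\mathcal U})$ for all $\|x\|_X<r$, $u\in\mathcal U$, $t\ge\tau$. A forward complete control system is bUAG (respectively UAG) if there is $\gamma\in\mathcal K_\infty$ such that for all $\varepsilon,r>0$ there is $\tau\ge 0$ such that $\|\phi(t,x,u)\|_X\le\varepsilon+\gamma(\|u\|_{\mathcal U})$ for all $t\ge\tau$,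 $\|x\|_X\le r$ and all $u\in\mathcal U$ with $\|u\|_{\mathcal U}\le r$ (respectively all $u\in\mathcal U$). **Example.** Let $X=Y=\ell^2(\mathbb N_0,\mathbb R)$, $U=\mathbb R$, $\mathcal U=L^\infty(\mathbb R_0^+,\mathbb R)$, and consider $$\dot x_n(t)=\frac{-x_n(t)+x_n(t)^2x_0(t)-x_n(t)|x_n(t)|-\tfrac1{n^2}x_n(t)^3}{1+u(t)^2}\ \ (n\ge1),\qquad \dot x_0(t)=-\frac{x_0(t)}{1+u(t)^2},$$ with full-state output $y=x$. Then: 1. The unique maximal mild solutions of this equation (continuous $\ell^2$-valued solutions of the corresponding integral equation) exist and define a control system, with transition map $\tilde\phi$. 2. $\tilde\phi(t,x,u)=\tilde\phi\bigl(\int_0^t\frac{1}{1+u(\theta)^2}\,d\theta,\,x,\,0\bigr)$ for all $t\ge0$, $x\in X$, $u\in\mathcal U$. 3. The system is FC, OUAG with zero gain (in particular OUAG), and ULS. 4. The system is neither OGUAG nor BORS. Consequently, for forward complete control systems with outputs, OUAG does not imply OGUAG, and for forward complete control systems, bUAG does not imply UAG. -/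

import Mathlib

open MeasureTheory Set
open scoped NNReal ENNReal

/-! ### Comparison functions -/

/-- Class `K_∞`: continuous, strictly increasing, zero at zero and unbounded. -/
structure IsClassKInf (γ : ℝ≥0 → ℝ≥0) : Prop where
  map_zero : γ 0 = 0
  continuous : Continuous γ
  strictMono : StrictMono γ
  unbounded : ¬ BddAbove (range γ)

/-! ### Control systems with time set `ℝ≥0` -/

/-- A space of inputs: a linear space of functions `ℝ≥0 → U` with a norm, satisfying the axioms of
shift invariance and of restriction invariance. As usual for spaces such as `L^∞`, the elements are
functions and the "norm" is a seminorm: two inputs at distance zero are identified (see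
`ControlSystem.congr`). -/
structure InputSpace (U : Type*) [AddCommGroup U] [Module ℝ U] where
  carrier : Submodule ℝ (ℝ≥0 → U)
  norm : Seminorm ℝ carrier
  shift_mem : ∀ u ∈ carrier, ∀ τ : ℝ≥0, (fun t => u (t + τ)) ∈ carrier
  shift_norm_le : ∀ (u : carrier) (τ : ℝ≥0),
    norm ⟨fun t => u.1 (t + τ), shift_mem u.1 u.2 τ⟩ ≤ norm u
  restrict_mem : ∀ u ∈ carrier, ∀ t₁ t₂ : ℝ≥0, t₁ ≤ t₂ → (Icc t₁ t₂).indicator u ∈ carrier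
  restrict_norm_le : ∀ (u : carrier) (t₁ t₂ : ℝ≥0) (h : t₁ ≤ t₂),
    norm ⟨(Icc t₁ t₂).indicator u.1, restrict_mem u.1 u.2 t₁ t₂ h⟩ ≤ norm u

namespace InputSpace

variable {U : Type*} [AddCommGroup U] [Module ℝ U] (𝒰 : InputSpace U)

/-- The norm of an input, as a nonnegative real number. -/
def size (u : 𝒰.carrier) : ℝ≥0 := ⟨𝒰.norm u, apply_nonneg 𝒰.norm u⟩

/-- The shifted input `u(· + τ)`. -/
def shift (u : 𝒰.carrier) (τ : ℝ≥0) : 𝒰.carrier :=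
  ⟨fun t => u.1 (t + τ), 𝒰.shift_mem u.1 u.2 τ⟩

end InputSpace

/-- A (not necessarily forward complete) control system in continuous time. The trajectory
`t ↦ φ t x u` has the maximal domain of definition `[0, tmax x u)`; the values of the total function
`φ` outside of it carry no meaning. -/
structure ControlSystem (X : Type*) [NormedAddCommGroup X] [NormedSpace ℝ X]
    {U : Type*} [AddCommGroup U] [Module ℝ U] (𝒰 : InputSpace U) where
  tmax : X → 𝒰.carrier → ℝ≥0∞
  tmax_pos : ∀ x u, 0 < tmax x u
  φ : ℝ≥0 → X → 𝒰.carrier → X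
  /-- Inputs at distance zero are identified (no condition if the seminorm is a norm). -/
  congr : ∀ x u v, 𝒰.norm (u - v) = 0 →
    tmax x u = tmax x v ∧ ∀ t : ℝ≥0, (t : ℝ≥0∞) < tmax x u → φ t x u = φ t x v
  identity : ∀ x u, φ 0 x u = x
  causality : ∀ (t : ℝ≥0) x u v, (t : ℝ≥0∞) < tmax x u → (∀ s ≤ t, u.1 s = v.1 s) →
    (t : ℝ≥0∞) < tmax x v ∧ φ t x u = φ t x v
  cocycle : ∀ (t s : ℝ≥0) x u, ((t + s : ℝ≥0) : ℝ≥0∞) < tmax x u →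
    (s : ℝ≥0∞) < tmax (φ t x u) (𝒰.shift u t) ∧
      φ (t + s) x u = φ s (φ t x u) (𝒰.shift u t)

/-- A control system together with an output map `h : X × U → Y`. -/
structure OutputSystem (X : Type*) [NormedAddCommGroup X] [NormedSpace ℝ X]
    {U : Type*} [AddCommGroup U] [Module ℝ U] (𝒰 : InputSpace U) (Y : Type*)
    extends ControlSystem X 𝒰 where
  h : X → U → Y

namespace ControlSystem

variable {X : Type*} [NormedAddCommGroup X] [NormedSpace ℝ X]
  {U : Type*} [AddCommGroup U] [Module ℝ U] {𝒰 : InputSpace U} (S : ControlSystem X 𝒰)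

def ForwardComplete : Prop := ∀ (t : ℝ≥0) x u, (t : ℝ≥0∞) < S.tmax x u

/-- The system with full-state output `y = φ`. -/
def fullState : OutputSystem X 𝒰 X := { S with h := fun x _ => x }

/-- The uniform asymptotic gain property (uniform over all inputs). -/
def UAG : Prop :=
  ∃ γ, IsClassKInf γ ∧ ∀ ε r : ℝ≥0, 0 < ε → 0 < r → ∃ τ : ℝ≥0,
    ∀ (x : X) (u : 𝒰.carrier) (t : ℝ≥0), ‖x‖₊ ≤ r → τ ≤ t →
      ‖S.φ t x u‖₊ ≤ ε + γ (𝒰.size u)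

/-- The uniform asymptotic gain property on bounded sets (of states and inputs). -/
def BUAG : Prop :=
  ∃ γ, IsClassKInf γ ∧ ∀ ε r : ℝ≥0, 0 < ε → 0 < r → ∃ τ : ℝ≥0,
    ∀ (x : X) (u : 𝒰.carrier) (t : ℝ≥0), ‖x‖₊ ≤ r → 𝒰.size u ≤ r → τ ≤ t →
      ‖S.φ t x u‖₊ ≤ ε + γ (𝒰.size u)

end ControlSystem

/-! ### Properties of (forward complete) control systems with outputs -/

namespace OutputSystem

variable {X : Type*} [NormedAddCommGroup X] [NormedSpace ℝ X]
  {U : Type*} [AddCommGroup U] [Module ℝ U] {𝒰 : InputSpace U}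
  {Y : Type*} [NormedAddCommGroup Y] (S : OutputSystem X 𝒰 Y)

/-- The output `y(t, x, u) = h(φ(t, x, u), u(t))`. -/
def y (t : ℝ≥0) (x : X) (u : 𝒰.carrier) : Y := S.h (S.φ t x u) (u.1 t)

/-- Bounded output reachability sets. -/
def BORS : Prop :=
  ∀ C τ : ℝ≥0, 0 < C → ∃ M : ℝ≥0, ∀ (x : X) (u : 𝒰.carrier) (t : ℝ≥0),
    ‖x‖₊ < C → 𝒰.size u < C → t < τ → ‖S.y t x u‖₊ ≤ M

/-- Output-uniform local stability. For systems with full-state output this is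
uniform local stability (ULS). -/
def OULS : Prop :=
  ∃ (r : ℝ≥0) (σ γ : ℝ≥0 → ℝ≥0), 0 < r ∧ IsClassKInf σ ∧ IsClassKInf γ ∧
    ∀ (x : X) (u : 𝒰.carrier) (t : ℝ≥0), ‖x‖₊ < r → 𝒰.size u < r →
      ‖S.y t x u‖₊ ≤ σ ‖x‖₊ + γ (𝒰.size u)

/-- The estimate in the output-uniform asymptotic gain property, with the gain `γ`. -/
def OUAGWithGain (γ : ℝ≥0 → ℝ≥0) : Prop :=
  ∀ ε r s : ℝ≥0, 0 < ε → 0 < r → 0 < s → ∃ τ : ℝ≥0,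
    ∀ (x : X) (u : 𝒰.carrier) (t : ℝ≥0), ‖x‖₊ < r → 𝒰.size u < s → τ ≤ t →
      ‖S.y t x u‖₊ ≤ ε + γ (𝒰.size u)

/-- The output-uniform asymptotic gain property. -/
def OUAG : Prop := ∃ γ, IsClassKInf γ ∧ S.OUAGWithGain γ

/-- The output-global uniform asymptotic gain property. -/
def OGUAG : Prop :=
  ∃ γ, IsClassKInf γ ∧ ∀ ε r : ℝ≥0, 0 < ε → 0 < r → ∃ τ : ℝ≥0,
    ∀ (x : X) (u : 𝒰.carrier) (t : ℝ≥0), ‖x‖₊ < r → τ ≤ t →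
      ‖S.y t x u‖₊ ≤ ε + γ (𝒰.size u)

end OutputSystem

/-! ### The input space `L^∞(ℝ≥0, ℝ)` -/

/-- Lebesgue measure on the time set `[0, ∞)`. -/
noncomputable def timeMeasure : Measure ℝ≥0 := Measure.comap (fun t : ℝ≥0 => (t : ℝ)) volume

theorem quasiMeasurePreserving_add_nnreal (τ : ℝ≥0) :
    Measure.QuasiMeasurePreserving (fun t : ℝ≥0 => t + τ) timeMeasure timeMeasure := by
  have hm : Measurable (fun t : ℝ≥0 => t + τ) := measurable_id.add_const τ
  refine ⟨hm, ?_⟩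
  refine Measure.AbsolutelyContinuous.mk fun s hs h0 => ?_
  rw [Measure.map_apply hm hs]
  have key : ∀ A : Set ℝ≥0, timeMeasure A = volume ((fun t : ℝ≥0 => (t : ℝ)) '' A) :=
    fun A => (MeasurableEmbedding.subtype_coe
      (measurableSet_Ici (a := (0 : ℝ)))).comap_apply volume A
  rw [key] at h0 ⊢
  have h1 : (fun t : ℝ≥0 => (t : ℝ)) '' ((fun t : ℝ≥0 => t + τ) ⁻¹' s) ⊆
      (fun a : ℝ => a + (τ : ℝ)) ⁻¹' ((fun t : ℝ≥0 => (t : ℝ)) '' s) := by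
    rintro _ ⟨a, ha, rfl⟩
    exact ⟨a + τ, ha, by push_cast; rfl⟩
  refine measure_mono_null h1 ?_
  rw [measure_preimage_add_right]
  exact h0

theorem eLpNorm_top_comp_add_le (u : ℝ≥0 → ℝ) (τ : ℝ≥0) :
    eLpNorm (fun t => u (t + τ)) ∞ timeMeasure ≤ eLpNorm u ∞ timeMeasure := by
  rw [eLpNorm_exponent_top, eLpNorm_exponent_top]
  exact essSup_le_of_ae_le _ ((quasiMeasurePreserving_add_nnreal τ).ae
    (ae_le_eLpNormEssSup (f := u) (μ := timeMeasure)))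

/-- The linear space of measurable, essentially bounded functions `ℝ≥0 → ℝ`. -/
def lInftyCarrier : Submodule ℝ (ℝ≥0 → ℝ) where
  carrier := {u | MemLp u ∞ timeMeasure}
  add_mem' {a b} ha hb := MemLp.add (f := a) (g := b) ha hb
  zero_mem' := MemLp.zero
  smul_mem' c u hu := MemLp.const_smul (f := u) hu c

theorem eLpNorm_ne_top_of_mem_lInfty (u : lInftyCarrier) :
    eLpNorm u.1 ∞ timeMeasure ≠ ∞ := MemLp.eLpNorm_ne_top (f := u.1) u.2

/-- The norm `ess sup |u|`. -/
noncomputable def lInftyNorm : Seminorm ℝ lInftyCarrier :=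
  Seminorm.of (fun u => (eLpNorm u.1 ∞ timeMeasure).toReal)
    (fun u v => by
      have hu := eLpNorm_ne_top_of_mem_lInfty u
      have hv := eLpNorm_ne_top_of_mem_lInfty v
      have h : eLpNorm (u.1 + v.1) ∞ timeMeasure
          ≤ eLpNorm u.1 ∞ timeMeasure + eLpNorm v.1 ∞ timeMeasure :=
        eLpNorm_add_le (MemLp.aestronglyMeasurable u.2) (MemLp.aestronglyMeasurable v.2) le_top
      rw [← ENNReal.toReal_add hu hv]
      exact ENNReal.toReal_mono (ENNReal.add_ne_top.2 ⟨hu, hv⟩) h)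
    (fun c u => by
      have h : eLpNorm (c • u.1) ∞ timeMeasure = ‖c‖ₑ * eLpNorm u.1 ∞ timeMeasure :=
        eLpNorm_const_smul c u.1 ∞ timeMeasure
      change (eLpNorm (c • u.1) ∞ timeMeasure).toReal = _
      rw [h, ENNReal.toReal_mul, toReal_enorm])

/-- `L^∞(ℝ≥0, ℝ)`. -/
noncomputable def LInfty : InputSpace ℝ where
  carrier := lInftyCarrier
  norm := lInftyNorm
  shift_mem u hu τ :=
    ⟨(MemLp.aestronglyMeasurable hu).comp_quasiMeasurePreserving
      (quasiMeasurePreserving_add_nnreal τ),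
      (eLpNorm_top_comp_add_le u τ).trans_lt (MemLp.eLpNorm_lt_top hu)⟩
  shift_norm_le u τ :=
    ENNReal.toReal_mono (eLpNorm_ne_top_of_mem_lInfty u) (eLpNorm_top_comp_add_le u.1 τ)
  restrict_mem _ hu _ _ _ := MemLp.indicator measurableSet_Icc hu
  restrict_norm_le u _ _ _ :=
    ENNReal.toReal_mono (eLpNorm_ne_top_of_mem_lInfty u) (eLpNorm_indicator_le u.1)

/-! ### The system -/

/-- The state space `ℓ²(ℕ₀, ℝ)`. -/
abbrev EllTwo : Type := lp (fun _ : ℕ => ℝ) 2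

/-- The components of the vector field: `f₀(x) = -x₀` and
`fₙ(x) = -xₙ + xₙ² x₀ - xₙ |xₙ| - xₙ³ / n²` for `n ≥ 1`. -/
noncomputable def fieldCoord (x : ℕ → ℝ) (n : ℕ) : ℝ :=
  if n = 0 then -x 0
  else -x n + x n ^ 2 * x 0 - x n * |x n| - 1 / (n : ℝ) ^ 2 * x n ^ 3

theorem memℓp_fieldCoord (x : EllTwo) : Memℓp (fieldCoord x) 2 := by
  have hC : ∀ n, ‖fieldCoord x n‖ ≤ ‖((1 + 2 * ‖x‖ ^ 2 + ‖x‖) • x : EllTwo) n‖ := by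
    intro n
    have hb : ∀ k, |x k| ≤ ‖x‖ := fun k => lp.norm_apply_le_norm (by norm_num) x k
    have hn : 0 ≤ ‖x‖ := norm_nonneg x
    have hx0 := hb 0
    have hxn := hb n
    have ha : 0 ≤ |x n| := abs_nonneg _
    rw [lp.coeFn_smul, Pi.smul_apply, smul_eq_mul, Real.norm_eq_abs, Real.norm_eq_abs, abs_mul,
      abs_of_nonneg (by positivity : (0 : ℝ) ≤ 1 + 2 * ‖x‖ ^ 2 + ‖x‖)]
    unfold fieldCoord
    split_ifs with h
    · subst h
      rw [abs_neg]
      nlinarith [mul_nonneg (by positivity : (0 : ℝ) ≤ 2 * ‖x‖ ^ 2 + ‖x‖) ha]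
    · have h1 : (1 : ℝ) ≤ n := by exact_mod_cast Nat.one_le_iff_ne_zero.2 h
      have h2 : 1 / (n : ℝ) ^ 2 ≤ 1 := by
        rw [div_le_one (by positivity)]; nlinarith
      have h3 : (0 : ℝ) ≤ 1 / (n : ℝ) ^ 2 := by positivity
      have e1 : |x n ^ 2 * x 0| ≤ ‖x‖ ^ 2 * |x n| := by
        rw [abs_mul, abs_pow, pow_two, pow_two]
        calc |x n| * |x n| * |x 0| = |x n| * |x 0| * |x n| := by ring
          _ ≤ ‖x‖ * ‖x‖ * |x n| := by gcongr
      have e2 : |(x n * |x n|)| ≤ ‖x‖ * |x n| := by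
        rw [abs_mul, abs_abs]; gcongr
      have e3 : |1 / (n : ℝ) ^ 2 * x n ^ 3| ≤ ‖x‖ ^ 2 * |x n| := by
        rw [abs_mul, abs_pow, abs_of_nonneg h3]
        calc 1 / (n : ℝ) ^ 2 * |x n| ^ 3 ≤ 1 * |x n| ^ 3 := by gcongr
          _ = |x n| ^ 2 * |x n| := by ring
          _ ≤ ‖x‖ ^ 2 * |x n| := by gcongr
      calc |-x n + x n ^ 2 * x 0 - x n * |x n| - 1 / (n : ℝ) ^ 2 * x n ^ 3|
          ≤ |-x n| + |x n ^ 2 * x 0| + |(x n * |x n|)| + |1 / (n : ℝ) ^ 2 * x n ^ 3| :=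
            (abs_sub _ _).trans (add_le_add_left ((abs_sub _ _).trans
              (add_le_add_left (abs_add_le _ _) _)) _)
        _ ≤ (1 + 2 * ‖x‖ ^ 2 + ‖x‖) * |x n| := by
            rw [abs_neg]; linarith
  apply memℓp_gen
  have hs := (lp.memℓp ((1 + 2 * ‖x‖ ^ 2 + ‖x‖) • x : EllTwo)).summable (by norm_num)
  exact hs.of_nonneg_of_le (fun n => by positivity)
    (fun n => Real.rpow_le_rpow (norm_nonneg _) (hC n) (by norm_num))

/-- The vector field `f : ℓ² → ℓ²`. -/
noncomputable def field (x : EllTwo) : EllTwo := ⟨fieldCoord x, memℓp_fieldCoord x⟩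

/-- The time-rescaled right-hand side at time `θ` along `ξ`: `f(ξ(θ)) / (1 + u(θ)²)`. -/
noncomputable def rhs (u : ℝ≥0 → ℝ) (ξ : ℝ≥0 → EllTwo) (θ : ℝ≥0) : EllTwo :=
  (1 / (1 + u θ ^ 2)) • field (ξ θ)

/-- `ξ` is, on `[0, T)`, a mild solution of `ẋ(t) = f(x(t)) / (1 + u(t)²)`, `x(0) = x₀`:
it is continuous in `ℓ²` and `ξ(t) = x₀ + ∫₀ᵗ f(ξ(θ)) / (1 + u(θ)²) dθ` (Bochner integral). -/
structure IsMildSolution (u : ℝ≥0 → ℝ) (x₀ : EllTwo) (T : ℝ≥0∞) (ξ : ℝ≥0 → EllTwo) : Prop where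
  continuousOn : ContinuousOn ξ {t | (t : ℝ≥0∞) < T}
  integrableOn : ∀ t : ℝ≥0, (t : ℝ≥0∞) < T → IntegrableOn (rhs u ξ) (Icc 0 t) timeMeasure
  eq_integral : ∀ t : ℝ≥0, (t : ℝ≥0∞) < T → ξ t = x₀ + ∫ θ in Icc 0 t, rhs u ξ θ ∂timeMeasure

/-- The trajectories of `S` are the unique maximal mild solutions of
`ẋ(t) = f(x(t)) / (1 + u(t)²)`. -/
def IsRescaledSystem (S : ControlSystem EllTwo LInfty) : Prop :=
  ∀ (x : EllTwo) (u : LInfty.carrier),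
    IsMildSolution u.1 x (S.tmax x u) (fun t => S.φ t x u) ∧
    ∀ (T : ℝ≥0∞) (ξ : ℝ≥0 → EllTwo), IsMildSolution u.1 x T ξ →
      T ≤ S.tmax x u ∧ ∀ t : ℝ≥0, (t : ℝ≥0∞) < T → ξ t = S.φ t x u

/-- The rescaled time `s(t, u) = ∫₀ᵗ 1 / (1 + u(θ)²) dθ`. -/
noncomputable def rescaledTime (t : ℝ≥0) (u : ℝ≥0 → ℝ) : ℝ≥0 :=
  (∫ θ in Icc 0 t, 1 / (1 + u θ ^ 2) ∂timeMeasure).toNNReal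

/-! ### Elementary facts about `ℓ²` and the vector field -/

namespace EllTwo

/-! The input only changes the speed: with `s(t) = ∫₀ᵗ 1/(1+u²)`, the trajectory is the autonomous
semiflow of `x' = f(x)` evaluated at `s(t)`. Everything therefore reduces to that semiflow, where
`x₀(t) = e⁻ᵗ x₀(0)` and, for `n ≥ 1`, `xₙ xₙ' ≤ xₙ² (-1 + |xₙ| (|x₀| - 1) - xₙ²/n²)`
(`mul_field_apply_le`).

Global existence: a coordinate with `|xₙ x₀| < 1` initially never grows, and since `xₙ → 0` only
finitely many coordinates violate this. The cubic term confines each of those to height of order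
`n²`. The resulting a priori bound depends on the state itself, not only on its norm.

Uniform attraction: after a time depending only on the radius, `|x₀| ≤ 1/2`. The quadratic damping
then brings every coordinate below `2` within one unit of time, however high it was, and exponential
decay follows (`norm_le_of_large_time`). An input of size less than `s` slows time by a factor at
most `1 + s²`, which gives OUAG with zero gain and bUAG.

Failure of uniformity: start at `x₀ = 100`, `xₙ = 1`. Before time `1` the quadratic growth carries
the norm above a level that tends to infinity with `n`, from a fixed ball (`exists_norm_flow_gt`);
this refutes BORS. A constant input `k` delays this peak by the factor `1 + k²`. Choosing first `k`,
so that the peak occurs after the proposed `τ`, and then `n`, so that it exceeds `ε + γ(k)`, refutes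
OGUAG and UAG. -/

theorem abs_apply_le_norm (x : EllTwo) (n : ℕ) : |x n| ≤ ‖x‖ :=
  lp.norm_apply_le_norm (by norm_num) x n

/-- The coordinatewise absolute value. -/
noncomputable def absVal (x : EllTwo) : EllTwo :=
  ⟨fun n => |x n|, (lp.memℓp x).norm⟩

theorem absVal_apply (x : EllTwo) (n : ℕ) : absVal x n = |x n| := rfl

theorem norm_absVal (x : EllTwo) : ‖absVal x‖ = ‖x‖ :=
  le_antisymm (lp.norm_mono (by norm_num) fun n => by simp [absVal_apply])
    (lp.norm_mono (by norm_num) fun n => by simp [absVal_apply])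

theorem norm_le_of_abs_apply_le {x y : EllTwo} {a : ℝ} (ha : 0 ≤ a)
    (h : ∀ n, |x n| ≤ a * |y n|) : ‖x‖ ≤ a * ‖y‖ := by
  have h1 : ‖x‖ ≤ ‖a • y‖ := lp.norm_mono (by norm_num) fun n => by
    simpa [abs_mul, abs_of_nonneg ha] using h n
  rwa [norm_smul, Real.norm_of_nonneg ha] at h1

theorem norm_le_of_abs_apply_le_add {x y z : EllTwo} {a b : ℝ} (ha : 0 ≤ a) (hb : 0 ≤ b)
    (h : ∀ n, |x n| ≤ a * |y n| + b * |z n|) : ‖x‖ ≤ a * ‖y‖ + b * ‖z‖ := by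
  have h1 : ‖x‖ ≤ ‖a • absVal y + b • absVal z‖ := lp.norm_mono (by norm_num) fun n => by
    have : 0 ≤ a * |y n| + b * |z n| := by positivity
    rw [lp.coeFn_add, lp.coeFn_smul, lp.coeFn_smul]
    simpa [absVal_apply, abs_of_nonneg this] using h n
  refine h1.trans ((norm_add_le _ _).trans_eq ?_)
  rw [norm_smul, norm_smul, norm_absVal, norm_absVal, Real.norm_of_nonneg ha,
    Real.norm_of_nonneg hb]

end EllTwo

open EllTwo

theorem field_apply (x : EllTwo) (n : ℕ) : field x n = fieldCoord x n := rfl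

theorem field_apply_zero (x : EllTwo) : field x 0 = -x 0 := by simp [field_apply, fieldCoord]

theorem field_apply_of_ne_zero (x : EllTwo) {n : ℕ} (hn : n ≠ 0) :
    field x n = -x n + x n ^ 2 * x 0 - x n * |x n| - 1 / (n : ℝ) ^ 2 * x n ^ 3 := by
  simp [field_apply, fieldCoord, hn]

theorem one_div_sq_le_one (n : ℕ) : 1 / (n : ℝ) ^ 2 ≤ 1 := by
  rcases Nat.eq_zero_or_pos n with rfl | h
  · simp
  · have : (1 : ℝ) ≤ n := by exact_mod_cast h
    rw [div_le_one (by positivity)]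
    nlinarith

/-- The coordinate `x 0` enters every component, so the difference in the `n`-th component is not
controlled by `|(x - y) n|` alone. The extra term carries the factor `|y n|`, which keeps the bound
square summable in `n`. -/
theorem abs_field_sub_apply_le {x y : EllTwo} {R : ℝ} (hx : ‖x‖ ≤ R) (hy : ‖y‖ ≤ R) (n : ℕ) :
    |(field x - field y) n| ≤
      (1 + 2 * R + 5 * R ^ 2) * |(x - y) n| + R * ‖x - y‖ * |y n| := by
  have hR : 0 ≤ R := (norm_nonneg x).trans hx
  have hd0 : |x 0 - y 0| ≤ ‖x - y‖ := abs_apply_le_norm (x - y) 0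
  have ha := (abs_apply_le_norm x n).trans hx
  have hb := (abs_apply_le_norm y n).trans hy
  have ha0 := (abs_apply_le_norm x 0).trans hx
  rw [lp.coeFn_sub, lp.coeFn_sub, Pi.sub_apply, Pi.sub_apply]
  have hd : 0 ≤ |x n - y n| := abs_nonneg _
  rcases eq_or_ne n 0 with rfl | hn
  · rw [field_apply_zero, field_apply_zero, neg_sub_neg, abs_sub_comm]
    have : 0 ≤ (2 * R + 5 * R ^ 2) * |x 0 - y 0| + R * ‖x - y‖ * |y 0| := by positivity
    linarith
  rw [field_apply_of_ne_zero x hn, field_apply_of_ne_zero y hn]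
  generalize x n = a at *
  generalize y n = b at *
  generalize x 0 = p at *
  generalize y 0 = q at *
  have hk0 : (0 : ℝ) ≤ 1 / (n : ℝ) ^ 2 := by positivity
  have hk1 := one_div_sq_le_one n
  generalize 1 / (n : ℝ) ^ 2 = k at *
  have e1 : |(a - b) * ((a + b) * p)| ≤ |a - b| * (2 * R ^ 2) := by
    rw [abs_mul, abs_mul]
    refine mul_le_mul_of_nonneg_left ?_ hd
    calc |a + b| * |p| ≤ (R + R) * R := by gcongr; exact (abs_add_le _ _).trans (add_le_add ha hb)
      _ = 2 * R ^ 2 := by ring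
  have e2 : |b ^ 2 * (p - q)| ≤ R * ‖x - y‖ * |b| := by
    rw [abs_mul, abs_pow]
    calc |b| ^ 2 * |p - q| = |b| * |p - q| * |b| := by ring
      _ ≤ R * ‖x - y‖ * |b| := by gcongr
  have e3 : |(a - b) * (|a|)| ≤ |a - b| * R := by
    rw [abs_mul, abs_abs]; gcongr
  have e4 : |b * (|a| - |b|)| ≤ R * |a - b| := by
    rw [abs_mul]
    exact mul_le_mul hb (abs_abs_sub_abs_le_abs_sub a b) (abs_nonneg _) hR
  have e5 : |k * ((a - b) * (a ^ 2 + a * b + b ^ 2))| ≤ 1 * (|a - b| * (3 * R ^ 2)) := by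
    rw [abs_mul, abs_mul, abs_of_nonneg hk0]
    refine mul_le_mul hk1 (mul_le_mul_of_nonneg_left ?_ hd) (by positivity) zero_le_one
    calc |a ^ 2 + a * b + b ^ 2| ≤ |a| ^ 2 + |a| * |b| + |b| ^ 2 := by
          refine (abs_add_three _ _ _).trans_eq ?_
          rw [abs_pow, abs_mul, abs_pow]
      _ ≤ R ^ 2 + R * R + R ^ 2 := by gcongr
      _ = 3 * R ^ 2 := by ring
  have hsplit : -a + a ^ 2 * p - a * |a| - k * a ^ 3 - (-b + b ^ 2 * q - b * |b| - k * b ^ 3) =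
      -(a - b) + (a - b) * ((a + b) * p) + b ^ 2 * (p - q) - (a - b) * |a| - b * (|a| - |b|)
        - k * ((a - b) * (a ^ 2 + a * b + b ^ 2)) := by ring
  rw [hsplit]
  have h0 : |-(a - b)| = |a - b| := abs_neg _
  refine abs_le.2 ⟨?_, ?_⟩
  · linarith [(abs_le.1 e1).1, (abs_le.1 e2).1, (abs_le.1 e3).2, (abs_le.1 e4).2,
      (abs_le.1 e5).2, (abs_le.1 h0.le).1]
  · linarith [(abs_le.1 e1).2, (abs_le.1 e2).2, (abs_le.1 e3).1, (abs_le.1 e4).1,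
      (abs_le.1 e5).1, (abs_le.1 h0.le).2]

/-- A Lipschitz constant of the vector field on the ball of radius `R`. -/
noncomputable def fieldLip (R : ℝ≥0) : ℝ≥0 := 1 + 2 * R + 6 * R ^ 2

theorem lipschitzOnWith_field (R : ℝ≥0) :
    LipschitzOnWith (fieldLip R) field (Metric.closedBall 0 R) := by
  refine LipschitzOnWith.of_dist_le_mul fun x hx y hy => ?_
  rw [mem_closedBall_zero_iff] at hx hy
  rw [dist_eq_norm, dist_eq_norm]
  have h := norm_le_of_abs_apply_le_add (by positivity) (by positivity)
    (abs_field_sub_apply_le hx hy)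
  refine h.trans ?_
  have : (R : ℝ) * ‖x - y‖ * ‖y‖ ≤ R * ‖x - y‖ * R := by gcongr
  simp only [fieldLip, NNReal.coe_add, NNReal.coe_one, NNReal.coe_mul, NNReal.coe_pow,
    NNReal.coe_ofNat]
  linarith

theorem field_zero : field 0 = 0 := by
  ext n
  simp [field_apply, fieldCoord]

theorem continuous_field : Continuous field := by
  refine continuous_iff_continuousAt.2 fun x => ?_
  have hx : Metric.closedBall (0 : EllTwo) (‖x‖₊ + 1 : ℝ≥0) ∈ nhds x :=
    Metric.closedBall_mem_nhds_of_mem (by simp)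
  exact (lipschitzOnWith_field _).continuousOn.continuousAt hx

/-- The dissipation estimate for the components of the vector field. -/
theorem mul_field_apply_le (x : EllTwo) {n : ℕ} (hn : n ≠ 0) :
    x n * field x n ≤ x n ^ 2 * (-1 + |x n| * (|x 0| - 1) - x n ^ 2 / (n : ℝ) ^ 2) := by
  rw [field_apply_of_ne_zero x hn]
  have h1 : x n * x 0 ≤ |x n| * |x 0| := by rw [← abs_mul]; exact le_abs_self _
  have h2 := mul_le_mul_of_nonneg_left h1 (sq_nonneg (x n))
  have e : x n * (-x n + x n ^ 2 * x 0 - x n * |x n| - 1 / (n : ℝ) ^ 2 * x n ^ 3) =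
    -x n ^ 2 + x n ^ 2 * (x n * x 0) - x n ^ 2 * |x n| - x n ^ 2 * (x n ^ 2 / (n : ℝ) ^ 2) := by
    ring
  rw [e]
  linarith

/-! ### Radial truncation -/

/-- The radial retraction onto the ball of radius `R`. -/
noncomputable def radialRetraction (R : ℝ) (x : EllTwo) : EllTwo := (R / max R ‖x‖) • x

theorem radialRetraction_of_norm_le {R : ℝ} (hR : 0 < R) {x : EllTwo} (hx : ‖x‖ ≤ R) :
    radialRetraction R x = x := by
  rw [radialRetraction, max_eq_left hx, div_self hR.ne', one_smul]

theorem norm_radialRetraction_le {R : ℝ} (hR : 0 < R) (x : EllTwo) :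
    ‖radialRetraction R x‖ ≤ R := by
  have hm : 0 < max R ‖x‖ := hR.trans_le (le_max_left _ _)
  rw [radialRetraction, norm_smul, Real.norm_of_nonneg (by positivity), div_mul_eq_mul_div,
    div_le_iff₀ hm]
  gcongr
  exact le_max_right _ _

/-- The constant `2` is crude but enough: composing `field` with the retraction yields a bounded,
globally Lipschitz field, to which Picard–Lindelöf applies on any time interval. -/
theorem lipschitzWith_radialRetraction {R : ℝ} (hR : 0 < R) :
    LipschitzWith 2 (radialRetraction R) := by
  refine LipschitzWith.of_dist_le_mul fun x y => ?_
  rw [dist_eq_norm, dist_eq_norm]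
  have hx : 0 < max R ‖x‖ := hR.trans_le (le_max_left _ _)
  have hy : 0 < max R ‖y‖ := hR.trans_le (le_max_left _ _)
  have e : radialRetraction R x - radialRetraction R y =
      (R / max R ‖x‖) • (x - y) + (R / max R ‖x‖ - R / max R ‖y‖) • y := by
    simp only [radialRetraction, smul_sub, sub_smul]; abel
  have h1 : ‖(R / max R ‖x‖) • (x - y)‖ ≤ ‖x - y‖ := by
    rw [norm_smul, Real.norm_of_nonneg (by positivity)]
    exact mul_le_of_le_one_left (norm_nonneg _) ((div_le_one hx).2 (le_max_left _ _))
  have h2 : ‖(R / max R ‖x‖ - R / max R ‖y‖) • y‖ ≤ ‖x - y‖ := by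
    have h3 : |max R ‖y‖ - max R ‖x‖| ≤ ‖x - y‖ := by
      refine (abs_max_sub_max_le_max _ _ _ _).trans ?_
      rw [sub_self, abs_zero, max_eq_right (abs_nonneg _), abs_sub_comm]
      exact abs_norm_sub_norm_le x y
    have h4 : R / max R ‖x‖ - R / max R ‖y‖ =
        R / max R ‖x‖ * ((max R ‖y‖ - max R ‖x‖) / max R ‖y‖) := by
      field_simp
    rw [norm_smul, h4, Real.norm_eq_abs, abs_mul, abs_of_nonneg (by positivity : 0 ≤ R / max R ‖x‖),
      abs_div, abs_of_pos hy]
    calc R / max R ‖x‖ * (|max R ‖y‖ - max R ‖x‖| / max R ‖y‖) * ‖y‖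
        ≤ 1 * (|max R ‖y‖ - max R ‖x‖| / max R ‖y‖) * max R ‖y‖ := by
          gcongr
          · exact (div_le_one hx).2 (le_max_left _ _)
          · exact le_max_right _ _
      _ = |max R ‖y‖ - max R ‖x‖| := by field_simp
      _ ≤ ‖x - y‖ := h3
  rw [e, NNReal.coe_ofNat]
  exact (norm_add_le _ _).trans (by linarith)

/-! ### Forward solutions of the autonomous equation: estimates -/

/-- `ψ` solves `ψ' = f(ψ)` on `[0, T]`, in the sense of right derivatives. -/
structure IsForwardSolution (T : ℝ) (ψ : ℝ → EllTwo) : Prop where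
  continuousOn : ContinuousOn ψ (Icc 0 T)
  hasDeriv : ∀ t ∈ Ico 0 T, HasDerivWithinAt ψ (field (ψ t)) (Ici t) t

namespace IsForwardSolution

variable {T : ℝ} {ψ : ℝ → EllTwo}

theorem mono (hψ : IsForwardSolution T ψ) {T' : ℝ} (h : T' ≤ T) : IsForwardSolution T' ψ :=
  ⟨hψ.continuousOn.mono (Icc_subset_Icc_right h),
    fun t ht => hψ.hasDeriv t ⟨ht.1, ht.2.trans_le h⟩⟩

theorem comp_add_right (hψ : IsForwardSolution T ψ) {a : ℝ} (ha : 0 ≤ a) :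
    IsForwardSolution (T - a) (fun t => ψ (t + a)) where
  continuousOn := hψ.continuousOn.comp (by fun_prop)
    fun t ht => ⟨by linarith [ht.1], by linarith [ht.2]⟩
  hasDeriv t ht := by
    have h := hψ.hasDeriv (t + a) ⟨by linarith [ht.1], by linarith [ht.2]⟩
    have h2 : HasDerivWithinAt (fun s : ℝ => s + a) 1 (Ici t) t :=
      ((hasDerivAt_id t).add_const a).hasDerivWithinAt
    have h3 := h.scomp t h2 fun s (hs : t ≤ s) => mem_Ici.2 (add_le_add_left hs a)
    rwa [one_smul] at h3

theorem hasDeriv_apply (hψ : IsForwardSolution T ψ) (n : ℕ) {t : ℝ} (ht : t ∈ Ico 0 T) :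
    HasDerivWithinAt (fun s => ψ s n) (field (ψ t) n) (Ici t) t :=
  (lp.evalCLM ℝ (fun _ : ℕ => ℝ) 2 n).hasFDerivAt.comp_hasDerivWithinAt t (hψ.hasDeriv t ht)

theorem continuousOn_apply (hψ : IsForwardSolution T ψ) (n : ℕ) :
    ContinuousOn (fun s => ψ s n) (Icc 0 T) :=
  (lp.evalCLM ℝ (fun _ : ℕ => ℝ) 2 n).continuous.comp_continuousOn hψ.continuousOn

theorem apply_zero (hψ : IsForwardSolution T ψ) {t : ℝ} (ht : t ∈ Icc 0 T) :
    ψ t 0 = Real.exp (-t) * ψ 0 0 := by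
  have h := constant_of_has_deriv_right_zero (a := 0) (b := T)
    (f := fun s => Real.exp s * ψ s 0)
    (Real.continuous_exp.continuousOn.mul (hψ.continuousOn_apply 0))
    (fun s hs =>
      ((Real.hasDerivAt_exp s).hasDerivWithinAt.mul (hψ.hasDeriv_apply 0 hs)).congr_deriv
        (by rw [field_apply_zero]; ring)) t ht
  simp only [Real.exp_zero, one_mul] at h
  rw [← h, ← mul_assoc, ← Real.exp_add]
  simp

theorem abs_apply_zero_le (hψ : IsForwardSolution T ψ) {t : ℝ} (ht : t ∈ Icc 0 T) :
    |ψ t 0| ≤ |ψ 0 0| := by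
  rw [hψ.apply_zero ht, abs_mul, Real.abs_exp]
  exact mul_le_of_le_one_left (abs_nonneg _) (Real.exp_le_one_iff.2 (by linarith [ht.1]))

/-- A component of a solution stays below a strict upper barrier. -/
theorem abs_apply_le_of_barrier (hψ : IsForwardSolution T ψ) (n : ℕ) {b b' : ℝ → ℝ}
    (hpos : ∀ t ∈ Icc 0 T, 0 < b t) (h0 : |ψ 0 n| ≤ b 0)
    (hb : ∀ t ∈ Icc 0 T, HasDerivAt b (b' t) t)
    (bound : ∀ t ∈ Ico 0 T, |ψ t n| = b t → ψ t n * field (ψ t) n < b t * b' t) :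
    ∀ t ∈ Icc 0 T, |ψ t n| ≤ b t := by
  intro t ht
  -- Squares are compared because `|ψ s n|` need not be differentiable where it vanishes. The
  -- derivative inequality is needed only at contact times.
  have h := image_le_of_deriv_right_lt_deriv_boundary' (a := 0) (b := T)
    (f := fun s => ψ s n ^ 2) (f' := fun s => 2 * (ψ s n * field (ψ s) n))
    (B := fun s => b s ^ 2) (B' := fun s => 2 * (b s * b' s))
    ((hψ.continuousOn_apply n).pow 2)
    (fun s hs => ((hψ.hasDeriv_apply n hs).pow 2).congr_deriv (by simp; ring))
    (by rw [← sq_abs]; gcongr)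
    (fun s hs => ((hb s hs).continuousAt.pow 2).continuousWithinAt)
    (fun s hs => ((hb s (Ico_subset_Icc_self hs)).hasDerivWithinAt.pow 2).congr_deriv
      (by simp; ring))
    (fun s hs he => by
      have := bound s hs ((sq_eq_sq₀ (abs_nonneg _) (hpos s (Ico_subset_Icc_self hs)).le).1
        (by rwa [sq_abs]))
      linarith) ht
  exact abs_le_of_sq_le_sq h (hpos t ht).le

/-- At a contact with the constant barrier `b`, the hypothesis `h` says exactly that the bracket in
`mul_field_apply_le`, with `C` in place of `|x 0|`, is negative. -/
theorem abs_apply_le_const (hψ : IsForwardSolution T ψ) {n : ℕ} (hn : n ≠ 0) {b C : ℝ}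
    (hb : 0 < b) (h0 : |ψ 0 n| ≤ b) (hC : |ψ 0 0| ≤ C)
    (h : b * (C - 1) - b ^ 2 / (n : ℝ) ^ 2 < 1) : ∀ t ∈ Icc 0 T, |ψ t n| ≤ b := by
  refine hψ.abs_apply_le_of_barrier n (b := fun _ => b) (b' := fun _ => 0) (fun _ _ => hb) h0
    (fun t _ => hasDerivAt_const t b) fun t ht he => ?_
  refine (mul_field_apply_le _ hn).trans_lt ?_
  rw [mul_zero, ← sq_abs (ψ t n), he]
  refine mul_neg_of_pos_of_neg (by positivity) ?_
  have h1 : |ψ t 0| ≤ C := (hψ.abs_apply_zero_le (Ico_subset_Icc_self ht)).trans hC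
  have h2 : b * (|ψ t 0| - 1) ≤ b * (C - 1) := by gcongr
  linarith

theorem abs_apply_le_of_mul_le_one (hψ : IsForwardSolution T ψ) (n : ℕ)
    (h : |ψ 0 n| * |ψ 0 0| < 1) : ∀ t ∈ Icc 0 T, |ψ t n| ≤ |ψ 0 n| := by
  intro t ht
  rcases eq_or_ne n 0 with rfl | hn
  · exact hψ.abs_apply_zero_le ht
  -- A barrier has to be positive and `ψ 0 n` may vanish, so barriers slightly above `|ψ 0 n|` are
  -- used; the strict hypothesis leaves room for them.
  have hev : ∀ᶠ b in nhdsWithin |ψ 0 n| (Ioi |ψ 0 n|), |ψ t n| ≤ b := by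
    have h1 : ∀ᶠ b in nhdsWithin |ψ 0 n| (Ioi |ψ 0 n|), b * |ψ 0 0| < 1 :=
      (((continuous_id.mul continuous_const).tendsto |ψ 0 n|).eventually
        (gt_mem_nhds h)).filter_mono nhdsWithin_le_nhds
    filter_upwards [h1, self_mem_nhdsWithin] with b hb1 hb2
    have hb : 0 < b := (abs_nonneg _).trans_lt hb2
    have h3 : 0 ≤ b ^ 2 / (n : ℝ) ^ 2 := by positivity
    exact hψ.abs_apply_le_const hn hb (le_of_lt hb2) le_rfl (by linarith) t ht
  exact ge_of_tendsto (Filter.tendsto_id.mono_left nhdsWithin_le_nhds) hev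

theorem abs_apply_le_of_abs_zero_le_one (hψ : IsForwardSolution T ψ) (n : ℕ)
    (h : |ψ 0 0| ≤ 1) : ∀ t ∈ Icc 0 T, |ψ t n| ≤ |ψ 0 n| := by
  intro t ht
  rcases eq_or_ne n 0 with rfl | hn
  · exact hψ.abs_apply_zero_le ht
  refine le_of_forall_gt_imp_ge_of_dense fun b hb => ?_
  have hb0 : 0 < b := (abs_nonneg _).trans_lt hb
  have h3 : 0 ≤ b ^ 2 / (n : ℝ) ^ 2 := by positivity
  exact hψ.abs_apply_le_const hn hb0 hb.le h (by linarith) t ht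

theorem norm_le_norm_of_abs_zero_le_one (hψ : IsForwardSolution T ψ) (h : |ψ 0 0| ≤ 1) :
    ∀ t ∈ Icc 0 T, ‖ψ t‖ ≤ ‖ψ 0‖ := fun t ht => by
  simpa using norm_le_of_abs_apply_le zero_le_one (x := ψ t) (y := ψ 0) fun n => by
    simpa using hψ.abs_apply_le_of_abs_zero_le_one n h t ht

/-- The cubic damping at work: at height `b ≥ n² (|ψ 0 0| + 1)`, the loss `b²/n²` is at least `b (|ψ
0 0| + 1)` and outweighs the growth `b (|ψ 0 0| - 1)`. The bound deteriorates with `n`, which leaves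
room for unbounded reachability sets. -/
theorem abs_apply_le_add (hψ : IsForwardSolution T ψ) (n : ℕ) :
    ∀ t ∈ Icc 0 T, |ψ t n| ≤ |ψ 0 n| + n ^ 2 * (|ψ 0 0| + 1) := by
  intro t ht
  rcases eq_or_ne n 0 with rfl | hn
  · simpa using hψ.abs_apply_zero_le ht
  have hn' : (0 : ℝ) < n := by positivity
  refine hψ.abs_apply_le_const hn (by positivity) (le_add_of_nonneg_right (by positivity))
    le_rfl ?_ t ht
  set b := |ψ 0 n| + n ^ 2 * (|ψ 0 0| + 1) with hb
  have hb0 : 0 < b := by positivity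
  have h1 : |ψ 0 0| + 1 ≤ b / n ^ 2 := by
    rw [le_div_iff₀ (by positivity), hb]
    linarith [abs_nonneg (ψ 0 n)]
  have h2 : b * (|ψ 0 0| + 1) ≤ b * (b / n ^ 2) := by gcongr
  have h3 : b * (b / (n : ℝ) ^ 2) = b ^ 2 / (n : ℝ) ^ 2 := by ring
  linarith

/-- When `|x 0| < 1`, the quadratic damping dominates the coupling term and the cubic term also
dissipates, so the linear decay rate survives. -/
theorem abs_apply_le_exp (hψ : IsForwardSolution T ψ) (n : ℕ) (h : |ψ 0 0| < 1) :
    ∀ t ∈ Icc 0 T, |ψ t n| ≤ Real.exp (-t) * |ψ 0 n| := by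
  intro t ht
  rcases eq_or_ne n 0 with rfl | hn
  · rw [hψ.apply_zero ht, abs_mul, Real.abs_exp]
  have key : ∀ b, |ψ 0 n| < b → |ψ t n| ≤ Real.exp (-t) * b := fun b hb => by
    have hb0 : 0 < b := (abs_nonneg _).trans_lt hb
    refine hψ.abs_apply_le_of_barrier n (b := fun s => Real.exp (-s) * b)
      (b' := fun s => -(Real.exp (-s) * b)) (fun _ _ => by positivity) (by simpa using hb.le)
      (fun s _ => ?_) (fun s hs he => ?_) t ht
    · exact ((hasDerivAt_neg s).exp.mul_const b).congr_deriv (by ring)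
    · refine (mul_field_apply_le _ hn).trans_lt ?_
      rw [← sq_abs (ψ s n), he]
      set c := Real.exp (-s) * b
      have hc : 0 < c := by positivity
      have h1 : |ψ s 0| < 1 := (hψ.abs_apply_zero_le (Ico_subset_Icc_self hs)).trans_lt h
      have h2 : c * (|ψ s 0| - 1) < 0 := mul_neg_of_pos_of_neg hc (by linarith)
      have h3 : 0 ≤ c ^ 2 / (n : ℝ) ^ 2 := by positivity
      have h4 : c ^ 2 * (-1 + c * (|ψ s 0| - 1) - c ^ 2 / (n : ℝ) ^ 2) < c ^ 2 * -1 := by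
        gcongr; linarith
      linarith
  refine le_of_forall_gt_imp_ge_of_dense fun d hd => ?_
  have h5 := key (d / Real.exp (-t)) (by rwa [lt_div_iff₀' (Real.exp_pos _)])
  rwa [mul_div_cancel₀ _ (Real.exp_pos _).ne'] at h5

theorem norm_le_exp (hψ : IsForwardSolution T ψ) (h : |ψ 0 0| < 1) :
    ∀ t ∈ Icc 0 T, ‖ψ t‖ ≤ Real.exp (-t) * ‖ψ 0‖ := fun t ht =>
  norm_le_of_abs_apply_le (Real.exp_pos _).le fun n => hψ.abs_apply_le_exp n h t ht

/-- The quadratic damping brings all components below `2` within one unit of time. -/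
theorem abs_apply_le_two (hψ : IsForwardSolution T ψ) (n : ℕ) (h : |ψ 0 0| ≤ 1 / 2) :
    ∀ t ∈ Icc 1 T, |ψ t n| ≤ 2 := by
  intro t ht
  have ht0 : t ∈ Icc 0 T := ⟨zero_le_one.trans ht.1, ht.2⟩
  rcases eq_or_ne n 0 with rfl | hn
  · exact (hψ.abs_apply_zero_le ht0).trans (by linarith)
  set c := |ψ 0 n| + 1 with hc
  have hc0 : 0 < c := by positivity
  have hpos : ∀ s ∈ Icc 0 T, 0 < s + 2 / c := fun s hs =>
    add_pos_of_nonneg_of_pos hs.1 (by positivity)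
  -- The barrier solves `b' = -b²/2` with `b(0) = c > |ψ 0 n|`; for `s ≥ 1` it lies below `2`,
  -- whatever `c` is.
  have h1 := hψ.abs_apply_le_of_barrier n (b := fun s => 2 / (s + 2 / c))
    (b' := fun s => -2 / (s + 2 / c) ^ 2) (fun s hs => div_pos two_pos (hpos s hs))
    (by rw [zero_add, div_div_cancel₀ two_ne_zero]; linarith)
    (fun s hs => ((((hasDerivAt_id s).add_const (2 / c)).inv (hpos s hs).ne').const_mul
      2).congr_deriv (by simp; ring))
    (fun s hs he => by
      refine (mul_field_apply_le _ hn).trans_lt ?_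
      have hp := hpos s (Ico_subset_Icc_self hs)
      have e : 2 / (s + 2 / c) * (-2 / (s + 2 / c) ^ 2) =
        (2 / (s + 2 / c)) ^ 2 * (-(1 / 2) * (2 / (s + 2 / c))) := by
        field_simp
      rw [← sq_abs (ψ s n), he, e]
      set b := 2 / (s + 2 / c)
      have hb : 0 < b := by positivity
      have h1 : |ψ s 0| ≤ 1 / 2 := (hψ.abs_apply_zero_le (Ico_subset_Icc_self hs)).trans h
      have h2 : b * (|ψ s 0| - 1) ≤ b * (1 / 2 - 1) := by gcongr
      have h3 : 0 ≤ b ^ 2 / (n : ℝ) ^ 2 := by positivity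
      gcongr
      linarith) t ht0
  refine h1.trans ?_
  rw [div_le_iff₀ (hpos t ht0)]
  have : 0 < 2 / c := by positivity
  linarith [ht.1]

/-- Uniform attractivity on bounded sets. -/
theorem norm_le_of_large_time (hψ : IsForwardSolution T ψ) {r s : ℝ} (hr : 1 ≤ r)
    (h0 : ‖ψ 0‖ < r) (hs : 2 * r ≤ Real.exp s) (hs0 : 0 ≤ s) :
    ∀ t ∈ Icc (s + 1) T, ‖ψ t‖ ≤ Real.exp (-(t - (s + 1))) * (2 * r * ‖ψ 0‖) := by
  intro t ht
  have hx0 : |ψ 0 0| < r := (abs_apply_le_norm _ _).trans_lt h0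
  have hsT : s ∈ Icc 0 T := ⟨hs0, by linarith [ht.1, ht.2]⟩
  have hs1T : s + 1 ∈ Icc 0 T := ⟨by linarith, ht.1.trans ht.2⟩
  have hhalf : |ψ s 0| ≤ 1 / 2 := by
    rw [hψ.apply_zero hsT, abs_mul, Real.abs_exp, Real.exp_neg, inv_mul_le_iff₀ (Real.exp_pos _)]
    linarith
  -- Coordinates with `|ψ 0 n| |ψ 0 0| < 1` never grow. The others satisfy `1 ≤ r |ψ 0 n|`, so the
  -- absolute bound `2` becomes `2 r |ψ 0 n|`. A bound proportional to `|ψ 0 n|` can be summed over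
  -- `n`.
  have hcoord : ∀ n, |ψ (s + 1) n| ≤ 2 * r * |ψ 0 n| := fun n => by
    rcases lt_or_ge (|ψ 0 n| * |ψ 0 0|) 1 with h | h
    · refine (hψ.abs_apply_le_of_mul_le_one n h _ hs1T).trans ?_
      exact le_mul_of_one_le_left (abs_nonneg _) (by linarith)
    · have h1 := (hψ.comp_add_right hs0).abs_apply_le_two n (by simpa using hhalf) 1
        ⟨le_rfl, by linarith [hs1T.2]⟩
      rw [add_comm 1 s] at h1
      have h2 : |ψ 0 n| * |ψ 0 0| ≤ |ψ 0 n| * r := by gcongr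
      linarith
  have h1 := (hψ.comp_add_right hs1T.1).norm_le_exp (by
    rw [zero_add]
    refine lt_of_le_of_lt ?_ (show (1 / 2 : ℝ) < 1 by norm_num)
    have h2 := (hψ.comp_add_right hs0).abs_apply_zero_le (t := 1)
      ⟨zero_le_one, by linarith [hs1T.2]⟩
    rw [zero_add, add_comm 1 s] at h2
    exact h2.trans hhalf) (t - (s + 1)) ⟨by linarith [ht.1], by linarith [ht.2]⟩
  simp only [sub_add_cancel, zero_add] at h1
  refine h1.trans ?_
  gcongr
  exact norm_le_of_abs_apply_le (by linarith) hcoord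

end IsForwardSolution

theorem EllTwo.finite_setOf_one_le_mul (x : EllTwo) (C : ℝ) : {n | 1 ≤ |x n| * C}.Finite := by
  have h1 : Summable fun n => ‖x n‖ ^ (2 : ℝ≥0∞).toReal := (lp.memℓp x).summable (by norm_num)
  have h2 : Filter.Tendsto (fun n => |x n| * C) Filter.cofinite (nhds 0) := by
    have h3 : Filter.Tendsto (fun n => |x n| ^ 2) Filter.cofinite (nhds 0) := by
      simpa using h1.tendsto_cofinite_zero
    have h4 := (h3.sqrt).mul_const C
    simpa [Real.sqrt_sq_eq_abs] using h4
  have h5 := h2.eventually (gt_mem_nhds zero_lt_one)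
  simpa [Filter.eventually_cofinite] using h5

/-- A priori bound: solutions stay in a ball that depends on the initial state only. -/
theorem exists_norm_le_of_isForwardSolution (x : EllTwo) :
    ∃ B : ℝ, 0 ≤ B ∧ ∀ (T : ℝ) (ψ : ℝ → EllTwo), IsForwardSolution T ψ → ψ 0 = x →
      ∀ t ∈ Icc 0 T, ‖ψ t‖ ≤ B := by
  classical
  set F := (x.finite_setOf_one_le_mul |x 0|).toFinset
  -- The allowance from `abs_apply_le_add`, placed on the finitely many coordinates that can grow;
  -- finiteness is what puts it in `ℓ²`.
  set y : EllTwo := ∑ k ∈ F, lp.single 2 k ((k : ℝ) ^ 2 * (|x 0| + 1))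
  refine ⟨1 * ‖x‖ + 1 * ‖y‖, by positivity, fun T ψ hψ h0 t ht => ?_⟩
  refine norm_le_of_abs_apply_le_add zero_le_one zero_le_one fun n => ?_
  rw [one_mul, one_mul]
  subst h0
  rcases lt_or_ge (|ψ 0 n| * |ψ 0 0|) 1 with h | h
  · exact (hψ.abs_apply_le_of_mul_le_one n h t ht).trans (le_add_of_nonneg_right (abs_nonneg _))
  · refine (hψ.abs_apply_le_add n t ht).trans ?_
    gcongr
    have hn : n ∈ F := by simpa [F] using h
    have : y n = (n : ℝ) ^ 2 * (|ψ 0 0| + 1) := by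
      simp only [y, lp.coeFn_sum, Finset.sum_apply, lp.single_apply]
      rw [Finset.sum_eq_single n]
      · simp
      · intro k _ hk
        simp [hk.symm]
      · exact fun h' => absurd hn h'
    rw [this]
    exact le_abs_self _

/-! ### The semiflow of the autonomous equation -/

theorem norm_field_le {R : ℝ≥0} {x : EllTwo} (hx : ‖x‖ ≤ R) : ‖field x‖ ≤ fieldLip R * R := by
  have h := (lipschitzOnWith_field R).dist_le_mul x (by simpa using hx) 0 (by simp)
  rw [field_zero, dist_zero_right, dist_zero_right] at h
  exact h.trans (by gcongr)

/-- The field is truncated at a radius `R` strictly above the a priori bound `B`. The truncated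
equation is solvable on all of `[0, T]`, and its solution never reaches the sphere where truncation
matters. -/
theorem exists_isForwardSolution (x : EllTwo) {T : ℝ} (hT : 0 ≤ T) :
    ∃ ψ : ℝ → EllTwo, ψ 0 = x ∧ IsForwardSolution T ψ := by
  obtain ⟨B, hB0, hB⟩ := exists_norm_le_of_isForwardSolution x
  obtain ⟨R, hBR⟩ : ∃ R : ℝ≥0, B < R := ⟨B.toNNReal + 1, by simp [hB0]⟩
  have hR : (0 : ℝ) < R := hB0.trans_lt hBR
  set v : EllTwo → EllTwo := fun z => field (radialRetraction R z) with hv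
  have hlip : LipschitzWith (fieldLip R * 2) v := by
    rw [← lipschitzOnWith_univ]
    exact (lipschitzOnWith_field R).comp (lipschitzWith_radialRetraction hR).lipschitzOnWith
      fun z _ => by simpa using norm_radialRetraction_le hR z
  obtain ⟨ψ, hψ0, hψ⟩ := (IsPicardLindelof.of_time_independent (f := v) (tmin := 0) (tmax := T)
    (t₀ := ⟨0, le_rfl, hT⟩) (x₀ := x) (a := fieldLip R * R * T.toNNReal) (r := 0)
    (L := fieldLip R * R) (K := fieldLip R * 2)
    (fun z _ => by simpa using norm_field_le (norm_radialRetraction_le hR z))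
    hlip.lipschitzOnWith
    (by simp [hT])).exists_eq_forall_mem_Icc_hasDerivWithinAt₀
  have hcont : ContinuousOn ψ (Icc 0 T) := fun t ht => (hψ t ht).continuousWithinAt
  have hsol : ∀ T' ≤ T, (∀ t ∈ Ico 0 T', ‖ψ t‖ ≤ R) → IsForwardSolution T' ψ := fun T' hT' hle =>
    ⟨hcont.mono (Icc_subset_Icc_right hT'), fun t ht => by
      have h1 := hψ t ⟨ht.1, ht.2.le.trans hT'⟩
      simp only [hv] at h1
      rw [radialRetraction_of_norm_le hR (hle t ht)] at h1
      have h2 : Icc 0 T ∈ nhdsWithin t (Ici t) :=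
        Filter.mem_of_superset (Icc_mem_nhdsGE (ht.2.trans_le hT')) (Icc_subset_Icc_left ht.1)
      exact h1.mono_of_mem_nhdsWithin h2⟩
  refine ⟨ψ, hψ0, hsol T le_rfl fun t ht => ?_⟩
  by_contra! hgt
  -- Its least element `m` is the first time with norm at least `R`. Up to `m` the original equation
  -- is solved, so the a priori bound gives norm at most `B < R` at `m`.
  set S : Set ℝ := Icc 0 T ∩ {t | (R : ℝ) ≤ ‖ψ t‖}
  have hSc : IsCompact S := by
    refine isCompact_Icc.of_isClosed_subset ?_ inter_subset_left
    exact hcont.norm.preimage_isClosed_of_isClosed isClosed_Icc isClosed_Ici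
  obtain ⟨m, hm, hmin⟩ := hSc.exists_isLeast ⟨t, Ico_subset_Icc_self ht, hgt.le⟩
  have h1 := hsol m hm.1.2 fun s hs => by
    by_contra! h
    exact absurd (hmin ⟨⟨hs.1, hs.2.le.trans hm.1.2⟩, h.le⟩) (not_le.2 hs.2)
  have h2 := hB m ψ h1 hψ0 m ⟨hm.1.1, le_rfl⟩
  have h3 : (R : ℝ) ≤ ‖ψ m‖ := hm.2
  linarith

theorem exists_closedBall_of_continuousOn {T : ℝ} {ψ χ : ℝ → EllTwo}
    (hψ : ContinuousOn ψ (Icc 0 T)) (hχ : ContinuousOn χ (Icc 0 T)) :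
    ∃ R : ℝ≥0, ∀ t ∈ Icc 0 T, ψ t ∈ Metric.closedBall 0 R ∧ χ t ∈ Metric.closedBall 0 R := by
  obtain ⟨A, hA⟩ := isCompact_Icc.exists_bound_of_continuousOn hψ
  obtain ⟨B, hB⟩ := isCompact_Icc.exists_bound_of_continuousOn hχ
  refine ⟨(max A B).toNNReal, fun t ht => ?_⟩
  rw [mem_closedBall_zero_iff, mem_closedBall_zero_iff]
  exact ⟨((hA t ht).trans (le_max_left _ _)).trans (Real.le_coe_toNNReal _),
    ((hB t ht).trans (le_max_right _ _)).trans (Real.le_coe_toNNReal _)⟩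

theorem IsForwardSolution.eqOn {T : ℝ} {ψ χ : ℝ → EllTwo} (hψ : IsForwardSolution T ψ)
    (hχ : IsForwardSolution T χ) (h0 : ψ 0 = χ 0) : EqOn ψ χ (Icc 0 T) := by
  obtain ⟨R, hR⟩ := exists_closedBall_of_continuousOn hψ.continuousOn hχ.continuousOn
  exact ODE_solution_unique_of_mem_Icc_right (v := fun _ => field)
    (s := fun _ => Metric.closedBall 0 R) (fun _ _ => lipschitzOnWith_field R)
    hψ.continuousOn hψ.hasDeriv (fun t ht => (hR t (Ico_subset_Icc_self ht)).1)
    hχ.continuousOn hχ.hasDeriv (fun t ht => (hR t (Ico_subset_Icc_self ht)).2) h0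

/-- The semiflow of `x' = f(x)`, extended to negative times by the initial state. -/
noncomputable def flow (x : EllTwo) (t : ℝ) : EllTwo :=
  (exists_isForwardSolution x (Nat.cast_nonneg (⌈t⌉₊ + 1))).choose (max t 0)

theorem flow_of_nonpos (x : EllTwo) {t : ℝ} (ht : t ≤ 0) : flow x t = x := by
  rw [flow, max_eq_right ht]
  exact (exists_isForwardSolution x (Nat.cast_nonneg (⌈t⌉₊ + 1))).choose_spec.1

theorem flow_zero (x : EllTwo) : flow x 0 = x := flow_of_nonpos x le_rfl

/-- `flow` chooses a solution on a horizon that varies with `t`; uniqueness makes these choices fit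
together into one trajectory. -/
theorem IsForwardSolution.eqOn_flow {T : ℝ} {ψ : ℝ → EllTwo} (hψ : IsForwardSolution T ψ) :
    EqOn ψ (flow (ψ 0)) (Icc 0 T) := by
  intro t ht
  obtain ⟨h1, h2⟩ :=
    (exists_isForwardSolution (ψ 0) (Nat.cast_nonneg (⌈t⌉₊ + 1))).choose_spec
  rw [flow, max_eq_left ht.1]
  refine (hψ.mono ht.2).eqOn (h2.mono ?_) h1.symm ⟨ht.1, le_rfl⟩
  push_cast
  linarith [Nat.le_ceil t]

theorem isForwardSolution_flow (x : EllTwo) (T : ℝ) : IsForwardSolution T (flow x) := by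
  rcases lt_or_ge T 0 with hT | hT
  · exact ⟨by simp [Icc_eq_empty (not_le.2 hT)], by simp [Ico_eq_empty (not_lt.2 hT.le)]⟩
  obtain ⟨ψ, h0, hψ⟩ := exists_isForwardSolution x hT
  subst h0
  have heq := hψ.eqOn_flow
  refine ⟨hψ.continuousOn.congr heq.symm, fun t ht => ?_⟩
  rw [← heq (Ico_subset_Icc_self ht)]
  refine (hψ.hasDeriv t ht).congr_of_eventuallyEq ?_ (heq (Ico_subset_Icc_self ht)).symm
  filter_upwards [Icc_mem_nhdsGE ht.2] with s hs
  exact (heq ⟨ht.1.trans hs.1, hs.2⟩).symm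

theorem continuous_flow (x : EllTwo) : Continuous (flow x) := by
  have h : flow x = fun t => flow x (max t 0) := by
    ext1 t
    rcases le_total t 0 with ht | ht
    · rw [max_eq_right ht, flow_of_nonpos x ht, flow_zero]
    · rw [max_eq_left ht]
  have h2 : ContinuousOn (flow x) (Ici 0) := fun t (ht : 0 ≤ t) =>
    ((isForwardSolution_flow x (t + 1)).continuousOn t
      ⟨ht, by linarith⟩).mono_of_mem_nhdsWithin <| by
        have : Iio (t + 1) ∈ nhds t := Iio_mem_nhds (by linarith)
        filter_upwards [self_mem_nhdsWithin, mem_nhdsWithin_of_mem_nhds this] with s hs hs2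
        exact ⟨hs, le_of_lt hs2⟩
  rw [h]
  exact h2.comp_continuous (by fun_prop) fun t => mem_Ici.2 (le_max_right _ _)

theorem hasDerivWithinAt_flow (x : EllTwo) {t : ℝ} (ht : 0 ≤ t) :
    HasDerivWithinAt (flow x) (field (flow x t)) (Ici t) t :=
  (isForwardSolution_flow x (t + 1)).hasDeriv t ⟨ht, by linarith⟩

theorem flow_add (x : EllTwo) {a b : ℝ} (ha : 0 ≤ a) (hb : 0 ≤ b) :
    flow x (a + b) = flow (flow x a) b := by
  have h := ((isForwardSolution_flow x (a + b)).comp_add_right ha).eqOn_flow (x := b)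
    ⟨hb, by linarith⟩
  simpa [add_comm] using h

/-! ### Change of time -/

/-- An integral form of Gronwall's inequality with zero initial datum. -/
theorem eq_zero_of_le_mul_integral {T K : ℝ} {d : ℝ → ℝ} (hd : ContinuousOn d (Icc 0 T))
    (hpos : ∀ t ∈ Icc 0 T, 0 ≤ d t) (h : ∀ t ∈ Icc 0 T, d t ≤ K * ∫ s in (0 : ℝ)..t, d s) :
    ∀ t ∈ Icc 0 T, d t = 0 := by
  intro t ht
  have hT : 0 ≤ T := ht.1.trans ht.2
  have hint : IntegrableOn d (Icc 0 T) := hd.integrableOn_Icc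
  have hI : ∀ s ∈ Icc 0 T, 0 ≤ ∫ r in (0 : ℝ)..s, d r := fun s hs =>
    intervalIntegral.integral_nonneg hs.1 fun r hr => hpos r ⟨hr.1, hr.2.trans hs.2⟩
  -- The differential form of Gronwall is applied to the primitive of `d`, whose right derivative is
  -- `d`.
  have h1 := norm_le_gronwallBound_of_norm_deriv_right_le (f := fun s => ∫ r in (0 : ℝ)..s, d r)
    (f' := d) (δ := 0) (K := K) (ε := 0) (a := 0) (b := T)
    (by
      have := intervalIntegral.continuousOn_primitive_interval (a := 0) (b := T) (f := d)
        (μ := volume) (by rwa [uIcc_of_le hT])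
      rwa [uIcc_of_le hT] at this)
    (fun s hs => by
      refine intervalIntegral.integral_hasDerivWithinAt_right (t := Ioi s) ?_ ?_ ?_
      · exact (hd.mono (by
          rw [uIcc_of_le hs.1]; exact Icc_subset_Icc_right hs.2.le)).intervalIntegrable
      · exact ⟨Ioc s T, Ioc_mem_nhdsGT hs.2, (hint.mono_set fun r hr =>
          ⟨hs.1.trans hr.1.le, hr.2⟩).aestronglyMeasurable⟩
      · exact (hd s (Ico_subset_Icc_self hs)).mono_of_mem_nhdsWithin
          (Filter.mem_of_superset (Ioc_mem_nhdsGT hs.2) fun r hr => ⟨hs.1.trans hr.1.le, hr.2⟩))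
    (by simp)
    (fun s hs => by
      have hs' := Ico_subset_Icc_self hs
      rw [Real.norm_of_nonneg (hpos s hs'), Real.norm_of_nonneg (hI s hs'), add_zero]
      exact h s hs') t ht
  have h2 : ∫ r in (0 : ℝ)..t, d r = 0 := by
    simpa [gronwallBound_ε0_δ0] using h1
  have h3 := h t ht
  rw [h2, mul_zero] at h3
  exact le_antisymm h3 (hpos t ht)

section TimeChange

variable {g : ℝ → ℝ}

theorem intervalIntegrable_of_bounded (hg : AEStronglyMeasurable g volume) (h0 : ∀ θ, 0 ≤ g θ)
    (h1 : ∀ θ, g θ ≤ 1) (a b : ℝ) : IntervalIntegrable g volume a b := by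
  refine (intervalIntegrable_const (c := (1 : ℝ))).mono_fun hg.restrict ?_
  exact Filter.Eventually.of_forall fun θ => by
    simpa [abs_of_nonneg (h0 θ)] using h1 θ

theorem intervalIntegrable_smul (hg : AEStronglyMeasurable g volume) (h0 : ∀ θ, 0 ≤ g θ)
    (h1 : ∀ θ, g θ ≤ 1) {k : ℝ → EllTwo} {a b : ℝ} (hk : ContinuousOn k (uIcc a b)) :
    IntervalIntegrable (fun θ => g θ • k θ) volume a b :=
  (intervalIntegrable_of_bounded hg h0 h1 a b).smul_continuousOn hk

/-- With `g` merely measurable the integrand may be discontinuous everywhere, but at a zero of `k`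
the bound `g ≤ 1` restores continuity. -/
theorem hasDerivAt_integral_smul_of_eq_zero (hg : AEStronglyMeasurable g volume)
    (h0 : ∀ θ, 0 ≤ g θ) (h1 : ∀ θ, g θ ≤ 1) {k : ℝ → EllTwo} (hk : Continuous k) (a : ℝ) {t : ℝ}
    (ht : k t = 0) : HasDerivAt (fun s => ∫ θ in a..s, g θ • k θ) 0 t := by
  have hc : ContinuousAt (fun θ => g θ • k θ) t := by
    rw [ContinuousAt, ht, smul_zero]
    refine squeeze_zero_norm (a := fun θ => ‖k θ‖) (fun θ => ?_) ?_
    · rw [norm_smul, Real.norm_of_nonneg (h0 θ)]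
      exact mul_le_of_le_one_left (norm_nonneg _) (h1 θ)
    · simpa [ht] using hk.norm.tendsto t
  have h := intervalIntegral.integral_hasDerivAt_right
    (intervalIntegrable_smul hg h0 h1 hk.continuousOn (a := a) (b := t))
    (hg.smul hk.aestronglyMeasurable).stronglyMeasurableAtFilter hc
  rwa [ht, smul_zero] at h

/-- Solutions of the autonomous equation, run at speed `g`, solve the rescaled equation. -/
theorem flow_integral_eq (hg : AEStronglyMeasurable g volume) (h0 : ∀ θ, 0 ≤ g θ)
    (h1 : ∀ θ, g θ ≤ 1) (x : EllTwo) {t : ℝ} (ht : 0 ≤ t) :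
    flow x (∫ θ in (0 : ℝ)..t, g θ) =
      x + ∫ r in (0 : ℝ)..t, g r • field (flow x (∫ θ in (0 : ℝ)..r, g θ)) := by
  have hgi := intervalIntegrable_of_bounded hg h0 h1
  set s : ℝ → ℝ := fun t => ∫ θ in (0 : ℝ)..t, g θ with hs
  have hsc : Continuous s := intervalIntegral.continuous_primitive hgi 0
  have hsub : ∀ a b, s b - s a = ∫ θ in a..b, g θ := fun a b =>
    intervalIntegral.integral_interval_sub_left (hgi _ _) (hgi _ _)
  have hsmono : Monotone s := fun a b hab => by
    rw [← sub_nonneg, hsub]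
    exact intervalIntegral.integral_nonneg hab fun θ _ => h0 θ
  have hs0 : s 0 = 0 := by simp [hs]
  have hk : Continuous fun r => field (flow x (s r)) :=
    continuous_field.comp ((continuous_flow x).comp hsc)
  have hki : ∀ a b, IntervalIntegrable (fun r => g r • field (flow x (s r))) volume a b :=
    fun a b => intervalIntegrable_smul hg h0 h1 hk.continuousOn
  -- Neither term need be differentiable at `r`, since `g` is only measurable, yet their difference
  -- is. Subtracting `s q • c`, with `c` the field at the base point, from both terms leaves two
  -- functions with right derivative zero.
  have hd : ∀ r ∈ Ico 0 t, HasDerivWithinAt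
      (fun r => flow x (s r) - ∫ q in (0 : ℝ)..r, g q • field (flow x (s q))) 0 (Ici r) r := by
    intro r hr
    set c := field (flow x (s r)) with hc
    -- The first-order expansion of the flow at `s r` is pulled back along `s`, which is monotone
    -- and `1`-Lipschitz, so the error remains `o(q - r)`.
    have e1 : HasDerivWithinAt (fun q => flow x (s q) - s q • c) 0 (Ici r) r := by
      have hf := hasDerivWithinAt_iff_isLittleO.1
        (hasDerivWithinAt_flow x (t := s r) (hs0 ▸ hsmono hr.1))
      have htend : Filter.Tendsto s (nhdsWithin r (Ici r)) (nhdsWithin (s r) (Ici (s r))) :=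
        hsc.continuousWithinAt.tendsto_nhdsWithin fun q hq => hsmono hq
      refine hasDerivWithinAt_iff_isLittleO.2 ?_
      refine ((hf.comp_tendsto htend).congr_left fun q => ?_).trans_isBigO ?_
      · simp only [Function.comp_apply, smul_zero, sub_smul, ← hc]
        abel
      · refine Asymptotics.IsBigO.of_bound 1 (Filter.Eventually.of_forall fun q => ?_)
        rw [one_mul, Function.comp_apply, hsub, Real.norm_eq_abs (q - r)]
        simpa using intervalIntegral.norm_integral_le_of_norm_le_const (a := r) (b := q) (f := g)
          (C := 1) fun θ _ => by simpa [abs_of_nonneg (h0 θ)] using h1 θ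
    have e2 := (hasDerivAt_integral_smul_of_eq_zero hg h0 h1 (k := fun q => field (flow x (s q)) - c)
      (hk.sub continuous_const) 0 (t := r) (sub_self _)).hasDerivWithinAt (s := Ici r)
    have e3 := e1.sub e2
    rw [sub_zero] at e3
    refine e3.congr_of_eventuallyEq (Filter.Eventually.of_forall fun q => ?_) ?_ <;>
    · simp only [Pi.sub_apply, smul_sub]
      rw [intervalIntegral.integral_sub (hki _ _) ((hgi _ _).smul_continuousOn continuousOn_const),
        intervalIntegral.integral_smul_const]
      simp [hs]
  have hcst := constant_of_has_deriv_right_zero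
    (((continuous_flow x).comp hsc).sub
      (intervalIntegral.continuous_primitive hki 0)).continuousOn hd t ⟨ht, le_rfl⟩
  simp only [Pi.sub_apply, Function.comp_apply, hs0, flow_zero, intervalIntegral.integral_same,
    sub_zero] at hcst
  exact sub_eq_iff_eq_add.1 hcst

/-- Uniqueness for the rescaled equation. -/
theorem eqOn_of_eq_integral (hg : AEStronglyMeasurable g volume) (h0 : ∀ θ, 0 ≤ g θ)
    (h1 : ∀ θ, g θ ≤ 1) {x : EllTwo} {T : ℝ} {ξ η : ℝ → EllTwo}
    (hξ : ContinuousOn ξ (Icc 0 T)) (hη : ContinuousOn η (Icc 0 T))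
    (eξ : ∀ t ∈ Icc 0 T, ξ t = x + ∫ r in (0 : ℝ)..t, g r • field (ξ r))
    (eη : ∀ t ∈ Icc 0 T, η t = x + ∫ r in (0 : ℝ)..t, g r • field (η r)) :
    EqOn ξ η (Icc 0 T) := by
  obtain ⟨R, hR⟩ := exists_closedBall_of_continuousOn hξ hη
  have hd := hξ.sub hη
  have key := eq_zero_of_le_mul_integral (K := fieldLip R) (d := fun t => ‖ξ t - η t‖) hd.norm
    (fun _ _ => norm_nonneg _) fun t ht => by
      have hsub : uIcc 0 t ⊆ Icc 0 T := by
        rw [uIcc_of_le ht.1]; exact Icc_subset_Icc_right ht.2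
      have i1 : IntervalIntegrable (fun r => g r • field (ξ r)) volume 0 t :=
        intervalIntegrable_smul hg h0 h1
        (continuous_field.comp_continuousOn (hξ.mono hsub))
      have i2 : IntervalIntegrable (fun r => g r • field (η r)) volume 0 t :=
        intervalIntegrable_smul hg h0 h1
        (continuous_field.comp_continuousOn (hη.mono hsub))
      have hi : IntervalIntegrable (fun r => (fieldLip R : ℝ) * ‖ξ r - η r‖) volume 0 t :=
        ((hd.norm.mono hsub).intervalIntegrable).const_mul _
      rw [eξ t ht, eη t ht, add_sub_add_left_eq_sub, ← intervalIntegral.integral_const_mul,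
        ← intervalIntegral.integral_sub i1 i2]
      refine intervalIntegral.norm_integral_le_of_norm_le ht.1
        (Filter.Eventually.of_forall fun r hr => ?_) hi
      have hr' : r ∈ Icc 0 T := ⟨hr.1.le, hr.2.trans ht.2⟩
      rw [← smul_sub, norm_smul, Real.norm_of_nonneg (h0 r)]
      have h3 := (lipschitzOnWith_field R).dist_le_mul _ (hR r hr').1 _ (hR r hr').2
      rw [dist_eq_norm, dist_eq_norm] at h3
      exact (mul_le_of_le_one_left (norm_nonneg _) (h1 r)).trans h3
  intro t ht
  exact sub_eq_zero.1 (norm_eq_zero.1 (key t ht))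

end TimeChange

/-! ### Integrals over the time set -/

theorem measurableEmbedding_coe_nnreal : MeasurableEmbedding (fun t : ℝ≥0 => (t : ℝ)) :=
  MeasurableEmbedding.subtype_coe measurableSet_Ici

theorem map_coe_timeMeasure :
    timeMeasure.map (fun t : ℝ≥0 => (t : ℝ)) = volume.restrict (Ici 0) := by
  rw [timeMeasure, measurableEmbedding_coe_nnreal.map_comap, NNReal.range_coe]

theorem preimage_coe_Icc (t : ℝ≥0) : (fun t : ℝ≥0 => (t : ℝ)) ⁻¹' Icc 0 (t : ℝ) = Icc 0 t := by
  ext s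
  simp

theorem setIntegral_timeMeasure {E : Type*} [NormedAddCommGroup E] [NormedSpace ℝ E]
    (F : ℝ≥0 → E) (t : ℝ≥0) :
    ∫ θ in Icc 0 t, F θ ∂timeMeasure = ∫ θ in (0 : ℝ)..t, F θ.toNNReal := by
  have h := measurableEmbedding_coe_nnreal.setIntegral_map (μ := timeMeasure)
    (fun θ : ℝ => F θ.toNNReal) (Icc 0 (t : ℝ))
  simp only [Real.toNNReal_coe, preimage_coe_Icc] at h
  rw [← h, map_coe_timeMeasure, Measure.restrict_restrict measurableSet_Icc,
    inter_eq_left.2 Icc_subset_Ici_self, integral_Icc_eq_integral_Ioc,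
    intervalIntegral.integral_of_le t.coe_nonneg]

theorem integrableOn_timeMeasure_iff {E : Type*} [NormedAddCommGroup E]
    (F : ℝ≥0 → E) (t : ℝ≥0) :
    IntegrableOn F (Icc 0 t) timeMeasure ↔
      IntervalIntegrable (fun θ : ℝ => F θ.toNNReal) volume 0 t := by
  have h := measurableEmbedding_coe_nnreal.integrableOn_map_iff (μ := timeMeasure)
    (f := fun θ : ℝ => F θ.toNNReal) (s := Icc 0 (t : ℝ))
  simp only [Function.comp_def, Real.toNNReal_coe, preimage_coe_Icc] at h
  rw [← h, map_coe_timeMeasure, IntegrableOn, Measure.restrict_restrict measurableSet_Icc,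
    inter_eq_left.2 Icc_subset_Ici_self, intervalIntegrable_iff_integrableOn_Icc_of_le t.coe_nonneg]
  rfl

/-! ### The speed `1 / (1 + u²)` and the rescaled time -/

/-- The speed `1 / (1 + u²)`, extended by zero to negative times. -/
noncomputable def timeRate (u : ℝ≥0 → ℝ) : ℝ → ℝ :=
  (Ici 0).indicator fun θ => 1 / (1 + u θ.toNNReal ^ 2)

theorem timeRate_of_nonneg (u : ℝ≥0 → ℝ) {θ : ℝ} (hθ : 0 ≤ θ) :
    timeRate u θ = 1 / (1 + u θ.toNNReal ^ 2) := indicator_of_mem (mem_Ici.2 hθ) _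

theorem timeRate_nonneg (u : ℝ≥0 → ℝ) (θ : ℝ) : 0 ≤ timeRate u θ :=
  indicator_nonneg (fun _ _ => by positivity) _

theorem timeRate_le_one (u : ℝ≥0 → ℝ) (θ : ℝ) : timeRate u θ ≤ 1 := by
  refine indicator_apply_le' (fun _ => ?_) fun _ => zero_le_one
  rw [div_le_one (by positivity)]
  linarith [sq_nonneg (u θ.toNNReal)]

theorem aestronglyMeasurable_timeRate {u : ℝ≥0 → ℝ} (hu : AEStronglyMeasurable u timeMeasure) :
    AEStronglyMeasurable (timeRate u) volume := by
  rw [timeRate, aestronglyMeasurable_indicator_iff measurableSet_Ici, ← map_coe_timeMeasure,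
    measurableEmbedding_coe_nnreal.aestronglyMeasurable_map_iff]
  simp only [Function.comp_def, Real.toNNReal_coe]
  exact (aestronglyMeasurable_const.add (hu.pow 2)).aemeasurable.const_div 1
    |>.aestronglyMeasurable

theorem coe_rescaledTime (t : ℝ≥0) (u : ℝ≥0 → ℝ) :
    (rescaledTime t u : ℝ) = ∫ θ in (0 : ℝ)..t, timeRate u θ := by
  rw [rescaledTime, Real.coe_toNNReal _ (integral_nonneg fun θ => by positivity),
    setIntegral_timeMeasure]
  refine intervalIntegral.integral_congr fun θ hθ => ?_
  rw [uIcc_of_le t.coe_nonneg] at hθ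
  exact (timeRate_of_nonneg u hθ.1).symm

theorem rescaledTime_zero_left (u : ℝ≥0 → ℝ) : rescaledTime 0 u = 0 := by
  rw [← NNReal.coe_inj, coe_rescaledTime]
  simp

theorem rescaledTime_const (t : ℝ≥0) (k : ℝ) :
    (rescaledTime t (fun _ => k) : ℝ) = t / (1 + k ^ 2) := by
  rw [rescaledTime, Real.coe_toNNReal _ (integral_nonneg fun θ => by positivity),
    setIntegral_timeMeasure]
  simp [div_eq_mul_inv]

theorem rescaledTime_zero_right (t : ℝ≥0) : rescaledTime t 0 = t := by
  rw [← NNReal.coe_inj]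
  exact (rescaledTime_const t 0).trans (by simp)

theorem rescaledTime_congr_of_forall_le {t : ℝ≥0} {u v : ℝ≥0 → ℝ} (h : ∀ s ≤ t, u s = v s) :
    rescaledTime t u = rescaledTime t v := by
  rw [rescaledTime, rescaledTime, setIntegral_congr_fun measurableSet_Icc fun θ hθ => ?_]
  simp only [h θ hθ.2]

theorem rescaledTime_congr_ae {u v : ℝ≥0 → ℝ} (h : u =ᵐ[timeMeasure] v) (t : ℝ≥0) :
    rescaledTime t u = rescaledTime t v := by
  rw [rescaledTime, rescaledTime, integral_congr_ae]
  filter_upwards [ae_restrict_of_ae h] with θ hθ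
  rw [hθ]

/-- Combined with the semigroup law `flow_add`, this gives the cocycle axiom. -/
theorem rescaledTime_add {u : ℝ≥0 → ℝ} (hu : AEStronglyMeasurable u timeMeasure) (t s : ℝ≥0) :
    rescaledTime (t + s) u = rescaledTime t u + rescaledTime s (fun r => u (r + t)) := by
  rw [← NNReal.coe_inj, NNReal.coe_add, coe_rescaledTime, coe_rescaledTime, coe_rescaledTime]
  have hi := intervalIntegrable_of_bounded (aestronglyMeasurable_timeRate hu) (timeRate_nonneg u)
    (timeRate_le_one u)
  rw [← intervalIntegral.integral_add_adjacent_intervals (hi 0 t) (hi t (t + s : ℝ≥0)),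
    add_right_inj]
  have h := intervalIntegral.integral_comp_add_right (a := 0) (b := s) (timeRate u) (t : ℝ)
  rw [zero_add, add_comm (s : ℝ), ← NNReal.coe_add] at h
  rw [← h]
  refine intervalIntegral.integral_congr fun θ hθ => ?_
  rw [uIcc_of_le s.coe_nonneg] at hθ
  simp only [timeRate_of_nonneg _ hθ.1, timeRate_of_nonneg u (add_nonneg hθ.1 t.coe_nonneg),
    Real.toNNReal_add hθ.1 t.coe_nonneg, Real.toNNReal_coe]

theorem continuous_rescaledTime {u : ℝ≥0 → ℝ} (hu : AEStronglyMeasurable u timeMeasure) :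
    Continuous fun t => (rescaledTime t u : ℝ) := by
  simp only [coe_rescaledTime]
  exact (intervalIntegral.continuous_primitive (intervalIntegrable_of_bounded
    (aestronglyMeasurable_timeRate hu) (timeRate_nonneg u) (timeRate_le_one u)) 0).comp
    NNReal.continuous_coe

/-- This converts an attraction time `A` of the flow into the attraction time `A (1 + s²)` for all
inputs of size below `s`. -/
theorem div_le_rescaledTime {u : LInfty.carrier} {s : ℝ≥0} (hs : LInfty.size u < s) (t : ℝ≥0) :
    (t : ℝ) / (1 + (s : ℝ) ^ 2) ≤ rescaledTime t u.1 := by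
  have hu : AEStronglyMeasurable u.1 timeMeasure := MemLp.aestronglyMeasurable u.2
  have hb : ∀ᵐ θ ∂timeMeasure, |u.1 θ| ≤ s := by
    have h1 : (eLpNorm u.1 ∞ timeMeasure).toReal ≤ s := (NNReal.coe_lt_coe.2 hs).le
    filter_upwards [ae_le_eLpNormEssSup (f := u.1) (μ := timeMeasure)] with θ hθ
    rw [← eLpNorm_exponent_top] at hθ
    have h2 := ENNReal.toReal_mono (eLpNorm_ne_top_of_mem_lInfty u) hθ
    rw [toReal_enorm] at h2
    exact h2.trans h1
  have e := setIntegral_timeMeasure (fun _ => 1 / (1 + (s : ℝ) ^ 2)) t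
  rw [intervalIntegral.integral_const, sub_zero, smul_eq_mul, mul_one_div] at e
  rw [← e, rescaledTime, Real.coe_toNNReal _ (integral_nonneg fun θ => by positivity)]
  refine integral_mono_ae ((integrableOn_timeMeasure_iff _ t).2 intervalIntegrable_const) ?_ ?_
  · refine (integrableOn_timeMeasure_iff _ t).2 ?_
    refine (intervalIntegrable_of_bounded (aestronglyMeasurable_timeRate hu) (timeRate_nonneg _)
      (timeRate_le_one _) 0 t).congr fun θ hθ => ?_
    rw [uIoc_of_le t.coe_nonneg] at hθ
    exact timeRate_of_nonneg _ hθ.1.le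
  · filter_upwards [ae_restrict_of_ae hb] with θ hθ
    have : u.1 θ ^ 2 ≤ (s : ℝ) ^ 2 := sq_le_sq' (abs_le.1 hθ).1 (abs_le.1 hθ).2
    gcongr

/-! ### The control system -/

theorem rhs_toNNReal (u : ℝ≥0 → ℝ) (ξ : ℝ≥0 → EllTwo) {θ : ℝ} (hθ : 0 ≤ θ) :
    rhs u ξ θ.toNNReal = timeRate u θ • field (ξ θ.toNNReal) := by
  rw [rhs, timeRate_of_nonneg u hθ]

theorem isMildSolution_flow {u : ℝ≥0 → ℝ} (hu : AEStronglyMeasurable u timeMeasure)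
    (x : EllTwo) : IsMildSolution u x ⊤ (fun t => flow x (rescaledTime t u)) := by
  have hc : Continuous fun t => flow x (rescaledTime t u) :=
    (continuous_flow x).comp (continuous_rescaledTime hu)
  refine ⟨hc.continuousOn, fun t _ => ?_, fun t _ => ?_⟩
  · rw [integrableOn_timeMeasure_iff]
    refine (intervalIntegrable_smul (aestronglyMeasurable_timeRate hu) (timeRate_nonneg u)
      (timeRate_le_one u)
      (continuous_field.comp (hc.comp continuous_real_toNNReal)).continuousOn).congr fun θ hθ => ?_
    rw [uIoc_of_le t.coe_nonneg] at hθ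
    exact (rhs_toNNReal u (fun t => flow x (rescaledTime t u)) hθ.1.le).symm
  · rw [coe_rescaledTime, flow_integral_eq (aestronglyMeasurable_timeRate hu) (timeRate_nonneg u)
      (timeRate_le_one u) x t.coe_nonneg, setIntegral_timeMeasure, add_right_inj]
    refine intervalIntegral.integral_congr fun θ hθ => ?_
    rw [uIcc_of_le t.coe_nonneg] at hθ
    simp only [rhs_toNNReal u _ hθ.1, coe_rescaledTime, Real.coe_toNNReal _ hθ.1]

theorem IsMildSolution.comp_toNNReal {u : ℝ≥0 → ℝ} {x : EllTwo} {T : ℝ≥0∞} {ξ : ℝ≥0 → EllTwo}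
    (h : IsMildSolution u x T ξ) {t : ℝ≥0} (ht : (t : ℝ≥0∞) < T) :
    ContinuousOn (fun r : ℝ => ξ r.toNNReal) (Icc 0 t) ∧ ∀ r ∈ Icc 0 (t : ℝ),
      ξ r.toNNReal = x + ∫ θ in (0 : ℝ)..r, timeRate u θ • field (ξ θ.toNNReal) := by
  have hlt : ∀ r ∈ Icc 0 (t : ℝ), (r.toNNReal : ℝ≥0∞) < T := fun r hr =>
    lt_of_le_of_lt (by exact_mod_cast Real.toNNReal_le_iff_le_coe.2 hr.2) ht
  refine ⟨h.continuousOn.comp continuous_real_toNNReal.continuousOn hlt, fun r hr => ?_⟩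
  rw [h.eq_integral _ (hlt r hr), setIntegral_timeMeasure, Real.coe_toNNReal _ hr.1,
    add_right_inj]
  refine intervalIntegral.integral_congr fun θ hθ => ?_
  rw [uIcc_of_le hr.1] at hθ
  exact rhs_toNNReal u ξ hθ.1

theorem IsMildSolution.eq_flow {u : ℝ≥0 → ℝ} (hu : AEStronglyMeasurable u timeMeasure)
    {x : EllTwo} {T : ℝ≥0∞} {ξ : ℝ≥0 → EllTwo} (h : IsMildSolution u x T ξ) {t : ℝ≥0}
    (ht : (t : ℝ≥0∞) < T) : ξ t = flow x (rescaledTime t u) := by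
  obtain ⟨c1, e1⟩ := h.comp_toNNReal ht
  obtain ⟨c2, e2⟩ := (isMildSolution_flow hu x).comp_toNNReal (ENNReal.coe_lt_top (r := t))
  have heq := eqOn_of_eq_integral (aestronglyMeasurable_timeRate hu) (timeRate_nonneg u)
    (timeRate_le_one u) c1 c2 e1 e2
  simpa using heq ⟨t.coe_nonneg, le_rfl⟩

/-- The control system generated by the rescaled equation. -/
noncomputable def rescaledSystem : ControlSystem EllTwo LInfty where
  tmax _ _ := ⊤
  tmax_pos _ _ := ENNReal.zero_lt_top
  φ t x u := flow x (rescaledTime t u.1)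
  congr x u v h := by
    refine ⟨rfl, fun t _ => ?_⟩
    have h1 : (eLpNorm (u.1 - v.1) ∞ timeMeasure).toReal = 0 := h
    have h2 : eLpNorm (u.1 - v.1) ∞ timeMeasure = 0 :=
      ((ENNReal.toReal_eq_zero_iff _).1 h1).resolve_right (eLpNorm_ne_top_of_mem_lInfty (u - v))
    rw [eLpNorm_exponent_top, eLpNormEssSup_eq_zero_iff] at h2
    rw [rescaledTime_congr_ae (h2.mono fun θ hθ => sub_eq_zero.1 hθ)]
  identity x u := by rw [rescaledTime_zero_left, NNReal.coe_zero, flow_zero]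
  causality t x u v _ h := by
    rw [rescaledTime_congr_of_forall_le h]
    exact ⟨ENNReal.coe_lt_top, rfl⟩
  cocycle t s x u _ := by
    refine ⟨ENNReal.coe_lt_top, ?_⟩
    rw [rescaledTime_add (MemLp.aestronglyMeasurable u.2), NNReal.coe_add,
      flow_add x (NNReal.coe_nonneg _) (NNReal.coe_nonneg _)]
    rfl

theorem isRescaledSystem_rescaledSystem : IsRescaledSystem rescaledSystem := fun x u =>
  have hu := MemLp.aestronglyMeasurable u.2
  ⟨isMildSolution_flow hu x, fun _ _ h => ⟨le_top, fun _ ht => h.eq_flow hu ht⟩⟩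

namespace IsRescaledSystem

variable {S : ControlSystem EllTwo LInfty}

/-- The time-changed flow is a mild solution on `[0, ∞)`, so maximality leaves no other value. -/
theorem tmax_eq_top (hS : IsRescaledSystem S) (x : EllTwo) (u : LInfty.carrier) : S.tmax x u = ⊤ :=
  top_le_iff.1 ((hS x u).2 ⊤ _ (isMildSolution_flow (MemLp.aestronglyMeasurable u.2) x)).1

theorem forwardComplete (hS : IsRescaledSystem S) : S.ForwardComplete := fun t x u => by
  rw [hS.tmax_eq_top]
  exact ENNReal.coe_lt_top

theorem φ_eq_flow (hS : IsRescaledSystem S) (t : ℝ≥0) (x : EllTwo)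
    (u : LInfty.carrier) :
    S.φ t x u = flow x (rescaledTime t u.1) :=
  (hS x u).1.eq_flow (MemLp.aestronglyMeasurable u.2) (hS.forwardComplete t x u)

end IsRescaledSystem

/-! ### Qualitative properties of the semiflow -/

theorem norm_flow_le_of_norm_lt_one {x : EllTwo} (hx : ‖x‖ < 1) {t : ℝ} (ht : 0 ≤ t) :
    ‖flow x t‖ ≤ ‖x‖ := by
  have h := (isForwardSolution_flow x t).norm_le_norm_of_abs_zero_le_one
    (by rw [flow_zero]; exact (abs_apply_le_norm x 0).trans hx.le) t ⟨ht, le_rfl⟩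
  rwa [flow_zero] at h

theorem exists_norm_flow_le {ε : ℝ} (hε : 0 < ε) (r : ℝ) :
    ∃ A : ℝ≥0, ∀ (x : EllTwo) (t : ℝ), ‖x‖ < r → A ≤ t → ‖flow x t‖ ≤ ε := by
  set c := max r 1
  have hc : 1 ≤ c := le_max_right _ _
  have hd : 0 ≤ 2 * c * c / ε := by positivity
  -- All three summands come from `exp y ≥ y + 1`: time `2c` gives `exp (2c) ≥ 2c`, one unit serves
  -- the quadratic damping, and the last summand makes the exponential decay beat `2c²/ε`.
  refine ⟨⟨2 * c + 1 + 2 * c * c / ε, by positivity⟩, fun x t hx ht => ?_⟩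
  replace ht : 2 * c + 1 + 2 * c * c / ε ≤ t := ht
  have hxc : ‖x‖ < c := hx.trans_le (le_max_left _ _)
  have h := (isForwardSolution_flow x t).norm_le_of_large_time hc (by rwa [flow_zero])
    (s := 2 * c) (by linarith [Real.add_one_le_exp (2 * c)]) (by linarith) t
    ⟨by linarith, le_rfl⟩
  rw [flow_zero] at h
  refine h.trans ?_
  rw [Real.exp_neg, inv_mul_le_iff₀ (Real.exp_pos _)]
  have h1 : 2 * c * c / ε ≤ Real.exp (t - (2 * c + 1)) := by
    linarith [Real.add_one_le_exp (t - (2 * c + 1))]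
  calc 2 * c * ‖x‖ ≤ 2 * c * c := by gcongr
    _ = 2 * c * c / ε * ε := by field_simp
    _ ≤ Real.exp (t - (2 * c + 1)) * ε := by gcongr

/-- Trajectories from a fixed ball reach arbitrarily large norms during `[1/2, 1]`. -/
theorem exists_norm_flow_gt (M : ℝ) :
    ∃ x : EllTwo, ‖x‖ < 102 ∧ ∃ t ∈ Icc (1 / 2 : ℝ) 1, M < ‖flow x t‖ := by
  obtain ⟨m, hm⟩ := exists_nat_ge M
  set n := m + 1
  have hn : n ≠ 0 := Nat.succ_ne_zero m
  have hn1 : (1 : ℝ) ≤ n := by exact_mod_cast Nat.one_le_iff_ne_zero.2 hn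
  have hMn : M ≤ n := hm.trans (by simp [n])
  set x : EllTwo := lp.single 2 0 (100 : ℝ) + lp.single 2 n (1 : ℝ)
  refine ⟨x, ?_, ?_⟩
  · refine (norm_add_le _ _).trans_lt ?_
    rw [lp.norm_single (by norm_num), lp.norm_single (by norm_num)]
    norm_num
  by_contra! hle
  have hsol := isForwardSolution_flow x 1
  have hx0 : x 0 = 100 := by simp [x, lp.single_apply, hn.symm]
  have hxn : x n = 1 := by simp [x, hn, lp.single_apply]
  -- `100/e > 35`, so `x 0` stays large enough throughout the unit interval to drive the growth of
  -- coordinate `n`.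
  have hlarge : ∀ t ∈ Icc (0 : ℝ) 1, 35 ≤ flow x t 0 := fun t ht => by
    rw [hsol.apply_zero ht, flow_zero, hx0]
    have h1 : Real.exp (-1) ≤ Real.exp (-t) := Real.exp_le_exp.2 (by linarith [ht.2])
    linarith [Real.exp_neg_one_gt_d9]
  have hinv : 1 / (n : ℝ) ^ 2 ≤ 1 := one_div_sq_le_one n
  have hinv0 : 0 ≤ 1 / (n : ℝ) ^ 2 := by positivity
  -- At a contact with level `1` the derivative is at least `35 - 3 > 0`.
  have hone : ∀ t ∈ Icc (0 : ℝ) 1, 1 ≤ flow x t n := fun t ht => by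
    have h := image_le_of_deriv_right_lt_deriv_boundary' (a := 0) (b := 1)
      (f := fun s => -flow x s n) (B := fun _ => -1) (B' := fun _ => 0)
      (hsol.continuousOn_apply n).neg (fun s hs => (hsol.hasDeriv_apply n hs).neg)
      (by simp [flow_zero, hxn]) continuousOn_const
      (fun s _ => hasDerivWithinAt_const _ _ _)
      (fun s hs he => by
        have h1 := hlarge s (Ico_subset_Icc_self hs)
        have h2 : flow x s n = 1 := neg_injective he
        rw [field_apply_of_ne_zero _ hn, h2]
        norm_num
        norm_num at hinv
        linarith) ht
    linarith
  have hhalf : ∀ t ∈ Icc (1 / 2 : ℝ) 1, t ∈ Icc (0 : ℝ) 1 := fun t ht =>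
    ⟨by linarith [ht.1], ht.2⟩
  -- As long as `1 ≤ y ≤ n`, each of the losses `y`, `y²`, `y³/n²` is at most `y²`, so `y' ≥ (35 -
  -- 3) y²` and `1/y` falls at rate at least `32`. Starting at most at `1`, it would be at most
  -- `-15` after time `1/2`, contradicting positivity.
  have hfin := image_le_of_deriv_right_le_deriv_boundary (a := 1 / 2) (b := 1)
    (f := fun s => (flow x s n)⁻¹) (B := fun s => 1 - 32 * (s - 1 / 2)) (B' := fun _ => -32)
    (((hsol.continuousOn_apply n).mono fun t ht => hhalf t ht).inv₀
      fun t ht => by linarith [hone t (hhalf t ht)])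
    (fun s hs => ((hsol.hasDeriv_apply n ⟨by linarith [hs.1], hs.2⟩).inv
      (by linarith [hone s (hhalf s (Ico_subset_Icc_self hs))])))
    (by simpa using inv_le_one_of_one_le₀ (hone (1 / 2) (by norm_num)))
    (by fun_prop)
    (fun s _ => by
      have h1 : HasDerivAt (fun s : ℝ => 1 - 32 * (s - 1 / 2)) (-32) s :=
        ((((hasDerivAt_id s).sub_const _).const_mul 32).const_sub 1).congr_deriv (by norm_num)
      exact h1.hasDerivWithinAt)
    (fun s hs => by
      have hs' := hhalf s (Ico_subset_Icc_self hs)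
      have h1 := hone s hs'
      have h2 := hlarge s hs'
      have h3 : flow x s n ≤ n := (le_abs_self _).trans <|
        (abs_apply_le_norm _ n).trans ((hle s (Ico_subset_Icc_self hs)).trans hMn)
      rw [div_le_iff₀ (by positivity), field_apply_of_ne_zero _ hn,
        abs_of_nonneg (zero_le_one.trans h1)]
      generalize flow x s n = y at *
      generalize flow x s 0 = p at *
      have hy2 : 0 ≤ y ^ 2 := sq_nonneg y
      have h4 : 1 / (n : ℝ) ^ 2 * y ^ 3 ≤ y ^ 2 := by
        have h5 : y ≤ (n : ℝ) ^ 2 := h3.trans (by nlinarith)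
        rw [one_div_mul_eq_div, div_le_iff₀ (by positivity)]
        calc y ^ 3 = y ^ 2 * y := by ring
          _ ≤ y ^ 2 * (n : ℝ) ^ 2 := by gcongr
      have h6 : y ≤ y ^ 2 := by nlinarith
      have h7 : y ^ 2 * 35 ≤ y ^ 2 * p := by gcongr
      linarith)
    (x := 1) ⟨by norm_num, le_rfl⟩
  have h1 := hone 1 (by norm_num)
  have h2 : 0 < (flow x 1 n)⁻¹ := by positivity
  norm_num at hfin
  linarith

/-! ### Stability properties of the rescaled system -/

theorem isClassKInf_id : IsClassKInf id :=
  ⟨rfl, continuous_id, strictMono_id, by simp [not_bddAbove_univ]⟩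

/-- A constant input. -/
def constInput (k : ℝ) : LInfty.carrier := ⟨fun _ => k, memLp_top_const k⟩

theorem lInfty_size_zero : LInfty.size 0 = 0 := NNReal.eq (map_zero LInfty.norm)

namespace IsRescaledSystem

variable {S : ControlSystem EllTwo LInfty}

theorem φ_eq_φ_rescaledTime (hS : IsRescaledSystem S) (t : ℝ≥0) (x : EllTwo)
    (u : LInfty.carrier) : S.φ t x u = S.φ (rescaledTime t u.1) x 0 := by
  rw [hS.φ_eq_flow, hS.φ_eq_flow]
  exact congrArg (fun s : ℝ≥0 => flow x s) (rescaledTime_zero_right _).symm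

theorem oUAGWithGain_zero (hS : IsRescaledSystem S) :
    S.fullState.OUAGWithGain (fun _ => 0) := by
  intro ε r s hε _ _
  obtain ⟨A, hA⟩ := exists_norm_flow_le (ε := ε) (NNReal.coe_pos.2 hε) r
  refine ⟨A * (1 + s ^ 2), fun x u t hx hu ht => ?_⟩
  change ‖S.φ t x u‖₊ ≤ ε + 0
  rw [add_zero, hS.φ_eq_flow]
  refine hA x _ hx (le_trans ?_ (div_le_rescaledTime hu t))
  rw [le_div_iff₀ (by positivity)]
  exact_mod_cast ht

/-- The zero gain is not of class `K_∞`; any larger gain works, and the identity is taken. -/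
theorem oUAG (hS : IsRescaledSystem S) : S.fullState.OUAG :=
  ⟨id, isClassKInf_id, fun ε r s hε hr hs =>
    (hS.oUAGWithGain_zero ε r s hε hr hs).imp fun _ h x u t hx hu ht =>
      (h x u t hx hu ht).trans (by gcongr; exact zero_le)⟩

theorem oULS (hS : IsRescaledSystem S) : S.fullState.OULS := by
  refine ⟨1, id, id, one_pos, isClassKInf_id, isClassKInf_id, fun x u t hx _ => ?_⟩
  change ‖S.φ t x u‖₊ ≤ ‖x‖₊ + LInfty.size u
  rw [hS.φ_eq_flow]
  exact (show ‖flow x (rescaledTime t u.1)‖₊ ≤ ‖x‖₊ from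
    norm_flow_le_of_norm_lt_one hx (NNReal.coe_nonneg _)).trans le_self_add

/-- The constant input `k` runs the flow at speed `1/(1 + k²)`, so a peak at time `s ∈ [1/2, 1]` is
moved to `s (1 + k²)`. The ball of initial states depends on neither `k` nor `M`. -/
theorem exists_norm_φ_gt (hS : IsRescaledSystem S) (k M : ℝ≥0) :
    ∃ (x : EllTwo) (t : ℝ≥0), ‖x‖₊ < 102 ∧ (1 + k ^ 2) / 2 ≤ t ∧ t ≤ 1 + k ^ 2 ∧
      M < ‖S.φ t x (constInput k)‖₊ := by
  obtain ⟨x, hx, s, hs, h⟩ := exists_norm_flow_gt M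
  have hk : (0 : ℝ) < 1 + (k : ℝ) ^ 2 := by positivity
  have hs0 : 0 ≤ s := le_trans (by norm_num) hs.1
  lift s to ℝ≥0 using hs0
  refine ⟨x, s * (1 + k ^ 2), hx, ?_, ?_, ?_⟩
  · rw [← NNReal.coe_le_coe]
    push_cast
    nlinarith [hs.1]
  · exact mul_le_of_le_one_left zero_le hs.2
  · rw [hS.φ_eq_flow]
    have e : (rescaledTime (s * (1 + k ^ 2)) (constInput k).1 : ℝ) = s := by
      refine (rescaledTime_const _ (k : ℝ)).trans ?_
      push_cast
      field_simp
    rw [e]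
    exact h

/-- The order of choices matters: `k = τ + 1` ensures `(1 + k²)/2 ≥ τ` and fixes the number `γ (size
u)`; only then is the initial state chosen so that the peak exceeds it. -/
theorem exists_not_norm_φ_le (hS : IsRescaledSystem S) (τ : ℝ≥0) (γ : ℝ≥0 → ℝ≥0) :
    ∃ (x : EllTwo) (u : LInfty.carrier) (t : ℝ≥0), ‖x‖₊ < 102 ∧ τ ≤ t ∧
      1 + γ (LInfty.size u) < ‖S.φ t x u‖₊ := by
  obtain ⟨x, t, hx, ht, -, h⟩ :=
    hS.exists_norm_φ_gt (τ + 1) (1 + γ (LInfty.size (constInput (τ + 1 : ℝ≥0))))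
  refine ⟨x, constInput (τ + 1 : ℝ≥0), t, hx, le_trans ?_ ht, h⟩
  rw [← NNReal.coe_le_coe]
  push_cast
  nlinarith [τ.coe_nonneg, sq_nonneg (τ : ℝ)]

theorem not_oGUAG (hS : IsRescaledSystem S) : ¬ S.fullState.OGUAG := by
  rintro ⟨γ, -, h⟩
  obtain ⟨τ, hτ⟩ := h 1 102 one_pos (by norm_num)
  obtain ⟨x, u, t, hx, ht, hgt⟩ := hS.exists_not_norm_φ_le τ γ
  exact absurd (hτ x u t hx ht) (not_le.2 hgt)

theorem not_uAG (hS : IsRescaledSystem S) : ¬ S.UAG := by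
  rintro ⟨γ, -, h⟩
  obtain ⟨τ, hτ⟩ := h 1 102 one_pos (by norm_num)
  obtain ⟨x, u, t, hx, ht, hgt⟩ := hS.exists_not_norm_φ_le τ γ
  exact absurd (hτ x u t hx.le ht) (not_le.2 hgt)

theorem bUAG (hS : IsRescaledSystem S) : S.BUAG := by
  refine ⟨id, isClassKInf_id, fun ε r hε _ => ?_⟩
  -- The radius `r + 1` turns the non-strict bounds of bUAG into the strict ones of OUAG.
  obtain ⟨τ, hτ⟩ := hS.oUAGWithGain_zero ε (r + 1) (r + 1) hε (by positivity) (by positivity)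
  exact ⟨τ, fun x u t hx hu ht => (hτ x u t (hx.trans_lt (lt_add_one r))
    (hu.trans_lt (lt_add_one r)) ht).trans (by gcongr; exact zero_le)⟩

/-- The zero input already suffices: its peaks occur by time `1`, from a fixed ball. -/
theorem not_bORS (hS : IsRescaledSystem S) : ¬ S.fullState.BORS := by
  intro h
  obtain ⟨M, hM⟩ := h 102 2 (by norm_num)
  obtain ⟨x, t, hx, -, ht, hgt⟩ := hS.exists_norm_φ_gt 0 M
  have h0 : constInput ((0 : ℝ≥0) : ℝ) = 0 := rfl
  rw [h0] at hgt
  refine absurd (hM x 0 t hx ?_ (ht.trans_lt (by norm_num))) (not_le.2 hgt)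
  rw [lInfty_size_zero]
  norm_num

end IsRescaledSystem

theorem mainTheorem11 :
    -- the equation defines a control system
    (∃ S : ControlSystem EllTwo LInfty, IsRescaledSystem S) ∧
    -- this system, with full-state output, has the asserted properties
    (∀ S : ControlSystem EllTwo LInfty, IsRescaledSystem S →
      (∀ (t : ℝ≥0) (x : EllTwo) (u : LInfty.carrier),
        S.φ t x u = S.φ (rescaledTime t u.1) x 0) ∧
      S.ForwardComplete ∧
      S.fullState.OUAGWithGain (fun _ => 0) ∧
      S.fullState.OUAG ∧
      S.fullState.OULS ∧
      ¬ S.fullState.OGUAG ∧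
      ¬ S.fullState.BORS) ∧
    -- OUAG does not imply OGUAG for forward complete systems
    (¬ ∀ (X U Y : Type) [NormedAddCommGroup X] [NormedSpace ℝ X] [AddCommGroup U] [Module ℝ U]
        [NormedAddCommGroup Y] [NormedSpace ℝ Y] (𝒰 : InputSpace U) (S : OutputSystem X 𝒰 Y),
        S.ForwardComplete → S.OUAG → S.OGUAG) ∧
    -- bUAG does not imply UAG for forward complete systems
    (¬ ∀ (X U : Type) [NormedAddCommGroup X] [NormedSpace ℝ X] [AddCommGroup U] [Module ℝ U]
        (𝒰 : InputSpace U) (S : ControlSystem X 𝒰),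
        S.ForwardComplete → S.BUAG → S.UAG) := by
  refine ⟨⟨rescaledSystem, isRescaledSystem_rescaledSystem⟩, fun S hS =>
    ⟨hS.φ_eq_φ_rescaledTime, hS.forwardComplete, hS.oUAGWithGain_zero, hS.oUAG, hS.oULS,
      hS.not_oGUAG, hS.not_bORS⟩, fun h => ?_, fun h => ?_⟩
  · have hS := isRescaledSystem_rescaledSystem
    exact hS.not_oGUAG (h EllTwo ℝ EllTwo LInfty rescaledSystem.fullState hS.forwardComplete hS.oUAG)
  · have hS := isRescaledSystem_rescaledSystem
    exact hS.not_uAG (h EllTwo ℝ LInfty rescaledSystem hS.forwardComplete hS.bUAG)
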